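/- Theorem (Stability). Let $A,Q\in\mathbb R^{k\times k}$, $B\in\mathbb R^{k\times l}$, $H\in\mathbb R^{m\times n}$, $R\in\mathbb R^{m\times m}$, $C\in\mathbb R^{k\times k}$, $E\in\mathbb R^{l\times l}$ with $Q,R,C,E$ symmetric positive definite, let all complex eigenvalues of $A$ have modulus $>1$, and let $p\ge 0$. Control setting: $S_{t+1}=AS_t+BU_t+W_t$ ($t\ge 0$), $S_0\sim\mathcal N(0,Q)$, $W_t\sim\mathcal N(0,Q)$; the channel is the $n$-input MIMO AWGN channel $Y_t=HX_t+Z_t$, $Z_t\sim\mathcal N(0,R)$. The encoder is linear and time-invariant: there are matrices $\Gamma\in\mathbb R^{n\times k}$ and $\Theta\succeq 0$ with $$X_t=\Gamma P_t^{-1}(S_t-\hat S_t)+M_t,\qquad \hat S_t=\mathbb E[S_t\mid Y_0,\dots,Y_{t-1}],\qquad P_t=\operatorname{Cov}(S_t-\hat S_t),\qquad M_t\sim\mathcal N(0,\Theta),$$ where $S_0$ and all $W_t,Z_t,M_t$, $t\ge0$, are mutually independent, and it must satisfy the power constraint $\limsup_{T\to\infty}\frac1T\sum_{t=1}^T\mathbb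 E[X_t^{\mathsf T}X_t]\le p$. A linear controller is a choice of such an encoder together with linear maps $G_t$ and controls $U_t=G_t(Y_0,\dots,Y_{t-1})$. It attains finite LQR cost if $$\limsup_{T\to\infty}\frac1T\,\mathbb E\Big[\sum_{t=1}^T\big(S_t^{\mathsf T}CS_t+U_t^{\mathsf T}EU_t\big)+S_T^{\mathsf T}CS_T\Big]<\infty,$$ and mean-squared stability if $\limsup_{t\to\infty}\mathbb E[S_t^{\mathsf T}S_t]<\infty$. Control-free system: the same with $S_{t+1}=AS_t+W_t$. A distortion $D$ is achievable for it if there are an encoder of the above form satisfying the power constraint and measurable decoders $g_t$ with $\limsup_{T\to\infty}\frac1T\sum_{t=1}^T\mathbb E\|S_t-g_t(Y_0,\dots,Y_{t-1})\|^2\le D$. Finally let $F$ be the positive semidefinite solution of $$F=C+A^{\mathsf T}\big(F-FB(E+B^{\mathsf T}FB)^{-1}B^{\mathsf T}F\big)A ,$$ which is unique if it exists, with the convention $\operatorname{Tr}(QF)=\infty$ if no such $F$ exists. Then some linear controller satisfying the power constraint attains both finite LQR cost and mean-squared stability if and only if some $D<\infty$ is achievable for the control-free system and $\operatorname{Tr}(QF)<\infty$.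 -/

import Mathlib

open MeasureTheory ProbabilityTheory Filter
open scoped ENNReal NNReal

namespace RemoteControl

/-- The space of `d`-dimensional real column vectors, with the Euclidean norm. -/
abbrev Vec (d : ℕ) : Type := EuclideanSpace ℝ (Fin d)

/-- The history `Y^{t-1} = (Y_0, …, Y_{t-1})` of a process (empty for `t = 0`). -/
def past {Ω : Type} {m : ℕ} (Y : ℕ → Ω → Vec m) (t : ℕ) (ω : Ω) : Fin t → Vec m :=
  fun i => Y i ω

/-- The one-step predictor `Ŝ_t = 𝔼[S_t | Y^{t-1}]` of the state from the past channel outputs. -/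
noncomputable def predictor {Ω : Type} [MeasurableSpace Ω] (μ : Measure Ω) {k m : ℕ}
    (S : ℕ → Ω → Vec k) (Y : ℕ → Ω → Vec m) (t : ℕ) : Ω → Vec k :=
  μ[S t | MeasurableSpace.comap (past Y t) inferInstance]

/-- The prediction error `S_t - Ŝ_t`. -/
noncomputable def predError {Ω : Type} [MeasurableSpace Ω] (μ : Measure Ω) {k m : ℕ}
    (S : ℕ → Ω → Vec k) (Y : ℕ → Ω → Vec m) (t : ℕ) (ω : Ω) : Vec k :=
  S t ω - predictor μ S Y t ω

/-- The prediction error covariance matrix `P_t = Cov(S_t - Ŝ_t)`. -/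
noncomputable def errorCov {Ω : Type} [MeasurableSpace Ω] (μ : Measure Ω) {k m : ℕ}
    (S : ℕ → Ω → Vec k) (Y : ℕ → Ω → Vec m) (t : ℕ) : Matrix (Fin k) (Fin k) ℝ :=
  Matrix.of fun i j =>
    covariance (fun ω => predError μ S Y t ω i) (fun ω => predError μ S Y t ω j) μ

/-- A linear system `S_{t+1} = A S_t + V_t + W_t` with additive input process `V`, Gaussian
disturbances `W_t ∼ N(0, Q)` and initial state `S_0 ∼ N(0, Q)`, whose state is encoded by a linear
time-invariant (innovations) feedback encoder into the input `X_t` of the MIMO AWGN channel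
`Y_t = H X_t + Z_t`, `Z_t ∼ N(0, R)`.  The encoder is
`X_t = Γ P_t⁻¹ (S_t - Ŝ_t) + M_t` with `M_t ∼ N(0, Θ)`, where the matrices `Γ` and `Θ` do not
depend on time. -/
structure CodedSystem {Ω : Type} [MeasurableSpace Ω] (μ : Measure Ω) {k m n : ℕ}
    (A Q : Matrix (Fin k) (Fin k) ℝ) (H : Matrix (Fin m) (Fin n) ℝ)
    (R : Matrix (Fin m) (Fin m) ℝ) (V : ℕ → Ω → Vec k) where
  /-- state -/
  S : ℕ → Ω → Vec k
  /-- channel input -/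
  X : ℕ → Ω → Vec n
  /-- channel output -/
  Y : ℕ → Ω → Vec m
  /-- process disturbance -/
  W : ℕ → Ω → Vec k
  /-- channel noise -/
  Z : ℕ → Ω → Vec m
  /-- encoder noise -/
  M : ℕ → Ω → Vec n
  /-- encoding matrix -/
  Γ : Matrix (Fin n) (Fin k) ℝ
  /-- covariance of the encoder noise -/
  Θ : Matrix (Fin n) (Fin n) ℝ
  posSemidef_Θ : Θ.PosSemidef
  measurable_S : ∀ t, Measurable (S t)
  measurable_X : ∀ t, Measurable (X t)
  measurable_Y : ∀ t, Measurable (Y t)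
  measurable_W : ∀ t, Measurable (W t)
  measurable_Z : ∀ t, Measurable (Z t)
  measurable_M : ∀ t, Measurable (M t)
  /-- law of the initial state -/
  law_init : HasLaw (S 0) (multivariateGaussian 0 Q) μ
  /-- at each time the disturbance, the channel noise and the encoder noise are independent,
  centred and Gaussian -/
  law_noise : ∀ t, HasLaw (fun ω => (W t ω, Z t ω, M t ω))
    ((multivariateGaussian 0 Q).prod
      ((multivariateGaussian 0 R).prod (multivariateGaussian 0 Θ))) μ
  /-- the noises at different times are independent -/
  indep_noise : iIndepFun (fun t ω => (W t ω, Z t ω, M t ω)) μ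
  /-- the initial state is independent of all the noises -/
  indep_init : IndepFun (S 0) (fun ω t => (W t ω, Z t ω, M t ω)) μ
  /-- state evolution -/
  state_eq : ∀ t ω, S (t + 1) ω = A.toEuclideanLin (S t ω) + V t ω + W t ω
  /-- channel -/
  channel_eq : ∀ t ω, Y t ω = H.toEuclideanLin (X t ω) + Z t ω
  /-- encoder -/
  encoder_eq : ∀ t, X t =ᵐ[μ] fun ω =>
    (Γ * (errorCov μ S Y t)⁻¹).toEuclideanLin (predError μ S Y t ω) + M t ω

/-- `limsup_{T → ∞} (1/T) ∑_{t=1}^T a_t`. -/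
noncomputable def longRunAverage (a : ℕ → ℝ≥0∞) : ℝ≥0∞ :=
  limsup (fun T : ℕ => (∑ t ∈ Finset.Icc 1 T, a t) / (T : ℝ≥0∞)) atTop

/-- The second moment `𝔼[X^T X]`, as an extended nonnegative number. -/
noncomputable def secondMoment {Ω : Type} [MeasurableSpace Ω] (μ : Measure Ω) {d : ℕ}
    (X : Ω → Vec d) : ℝ≥0∞ :=
  ∫⁻ ω, ‖X ω‖ₑ ^ 2 ∂μ

/-- The quadratic form `x^T G x`. -/
def quadForm {d : ℕ} (G : Matrix (Fin d) (Fin d) ℝ) (x : Vec d) : ℝ :=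
  x.ofLp ⬝ᵥ (G.mulVec x.ofLp)

/-- The infinite-horizon LQR cost
`limsup_{T → ∞} (1/T) 𝔼[∑_{t=1}^T (S_t^T C S_t + U_t^T E U_t) + S_T^T C S_T]`
(for positive semidefinite `C` and `E`). -/
noncomputable def lqrCost {Ω : Type} [MeasurableSpace Ω] (μ : Measure Ω) {k l : ℕ}
    (C : Matrix (Fin k) (Fin k) ℝ) (E : Matrix (Fin l) (Fin l) ℝ)
    (S : ℕ → Ω → Vec k) (U : ℕ → Ω → Vec l) : ℝ≥0∞ :=
  limsup (fun T : ℕ =>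
    ((∑ t ∈ Finset.Icc 1 T, ∫⁻ ω, ENNReal.ofReal (quadForm C (S t ω) + quadForm E (U t ω)) ∂μ)
      + ∫⁻ ω, ENNReal.ofReal (quadForm C (S T ω)) ∂μ) / (T : ℝ≥0∞)) atTop

/-- Mean-squared stability: `limsup_{t → ∞} 𝔼[S_t^T S_t] < ∞`. -/
def MeanSquareStable {Ω : Type} [MeasurableSpace Ω] (μ : Measure Ω) {k : ℕ}
    (S : ℕ → Ω → Vec k) : Prop :=
  limsup (fun t : ℕ => secondMoment μ (S t)) atTop < ⊤

/-- The control-free system `S_{t+1} = A S_t + W_t` can be estimated over the channel with average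
power at most `p` and long-term average mean-squared error at most `D`: there are a linear
time-invariant encoder and a decoder `Ŝ_t = g_t(Y^{t-1})` meeting both constraints. -/
def MSEAchievable {k m n : ℕ} (A Q : Matrix (Fin k) (Fin k) ℝ) (H : Matrix (Fin m) (Fin n) ℝ)
    (R : Matrix (Fin m) (Fin m) ℝ) (p D : ℝ≥0) : Prop :=
  ∃ (Ω : Type) (_ : MeasurableSpace Ω) (μ : Measure Ω) (_ : IsProbabilityMeasure μ)
    (sys : CodedSystem μ A Q H R (fun _ _ => 0))
    (g : (t : ℕ) → (Fin t → Vec m) → Vec k),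
    (∀ t, Measurable (g t)) ∧
    longRunAverage (fun t => secondMoment μ (sys.X t)) ≤ p ∧
    longRunAverage (fun t => secondMoment μ (fun ω => sys.S t ω - g t (past sys.Y t ω))) ≤ D

/-- In the remote control system `S_{t+1} = A S_t + B U_t + W_t`, some linear time-invariant
encoder with average power at most `p`, together with some linear controller
`U_t = G_t(Y^{t-1})`, attains both a finite LQR cost and mean-squared stability. -/
def FiniteCostAndStabilityAttainable {k l m n : ℕ} (A Q : Matrix (Fin k) (Fin k) ℝ)
    (B : Matrix (Fin k) (Fin l) ℝ) (H : Matrix (Fin m) (Fin n) ℝ)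
    (R : Matrix (Fin m) (Fin m) ℝ) (C : Matrix (Fin k) (Fin k) ℝ)
    (E : Matrix (Fin l) (Fin l) ℝ) (p : ℝ≥0) : Prop :=
  ∃ (Ω : Type) (_ : MeasurableSpace Ω) (μ : Measure Ω) (_ : IsProbabilityMeasure μ)
    (U : ℕ → Ω → Vec l)
    (sys : CodedSystem μ A Q H R (fun t ω => B.toEuclideanLin (U t ω)))
    (G : (t : ℕ) → (Fin t → Vec m) →ₗ[ℝ] Vec l),
    (∀ t ω, U t ω = G t (past sys.Y t ω)) ∧
    longRunAverage (fun t => secondMoment μ (sys.X t)) ≤ p ∧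
    lqrCost μ C E sys.S U < ⊤ ∧
    MeanSquareStable μ sys.S

/-- `F` is a positive semidefinite solution of the control algebraic Riccati equation
`F = C + A^T (F - M) A`, `M = F B (E + B^T F B)⁻¹ B^T F`. -/
def IsRiccatiSolution {k l : ℕ} (A : Matrix (Fin k) (Fin k) ℝ) (B : Matrix (Fin k) (Fin l) ℝ)
    (C : Matrix (Fin k) (Fin k) ℝ) (E : Matrix (Fin l) (Fin l) ℝ)
    (F : Matrix (Fin k) (Fin k) ℝ) : Prop :=
  F.PosSemidef ∧
    F = C + A.transpose *
      (F - F * B * (E + B.transpose * F * B)⁻¹ * B.transpose * F) * A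

/-- The full-information LQR cost `Tr(Q F)`, where `F` is the positive semidefinite solution of the
control algebraic Riccati equation, which is unique if it exists when `C` and `E` are positive
definite; the value is `∞` if there is no such `F`. -/
noncomputable def riccatiCost {k l : ℕ} (A Q : Matrix (Fin k) (Fin k) ℝ)
    (B : Matrix (Fin k) (Fin l) ℝ) (C : Matrix (Fin k) (Fin k) ℝ)
    (E : Matrix (Fin l) (Fin l) ℝ) : ℝ≥0∞ :=
  ⨅ (F : Matrix (Fin k) (Fin k) ℝ) (_ : IsRiccatiSolution A B C E F),
    ENNReal.ofReal (Q * F).trace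

end RemoteControl

/-! A control that is linear in the past outputs moves the state and its predictor by the same
amount. Prediction error, error covariance, channel input and channel output are therefore
unaffected, and controlled and control-free systems correspond to each other over the same channel
signals and at the same power (`shift`).

Necessity. Removing the control's contribution exhibits the mean-square stable state as an
estimation error of the control-free system, so some finite distortion is achievable. For the
Riccati equation, let F_j be value iteration from 0. Completing the square gives Bellman's
inequality, whence the sum of Tr(Q F_j) over j < T is at most the stage cost accumulated over T
steps, which is O(T). Since F_j increases and Q is positive definite, F_j stays bounded and
converges to a solution.

Sufficiency. A solution F yields a gain K for which F is a Lyapunov function of A + BK; feeding back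
K times the predicted state gives a contracting recursion driven by W_t and the prediction error
e_t. This requires E‖e_t‖² to be bounded uniformly in t, whereas achievability controls only time
averages. The expansion of A closes this gap. Let p_t(u) = E⟨u, e_t⟩². The factor P_t⁻¹ in the
encoder cancels P_t in the covariance of e_t with Y_t, so one output removes only a bounded amount:
p_{t+1}(w) ≥ p_t(Aᵀw) - g‖Aᵀw‖² (`le_integral_sq_predError_succ`). With T = (A⁻¹)ᵀ, iteration bounds
p_t(u) by g ∑‖T^j u‖² + p_{t+r}(T^r u). Powers of T decay geometrically while p grows at most
linearly, so the last term vanishes as r → ∞ (`bounded_of_expanding`).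

Underneath lies Gaussian regression (`exists_condExp_eq_linear`): the predictor is linear in the
past outputs and the error is independent of them. -/

namespace RemoteControl

open Matrix Topology

set_option linter.unusedSectionVars false

/-! ### The Riccati equation and value iteration. -/

section Riccati

variable {k l : ℕ}

theorem dotProduct_mulVec_comm_of_isHermitian {ι : Type*} [Fintype ι] {F : Matrix ι ι ℝ}
    (hF : F.IsHermitian) (x y : ι → ℝ) : x ⬝ᵥ F *ᵥ y = y ⬝ᵥ F *ᵥ x := by
  have h : Fᵀ = F := (conjTranspose_eq_transpose_of_trivial F).symm.trans hF
  rw [dotProduct_mulVec, ← mulVec_transpose, h, dotProduct_comm]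

theorem mulVec_dotProduct {ι κ : Type*} [Fintype ι] [Fintype κ] (P : Matrix ι κ ℝ)
    (x : κ → ℝ) (y : ι → ℝ) : (P *ᵥ x) ⬝ᵥ y = x ⬝ᵥ Pᵀ *ᵥ y := by
  rw [dotProduct_mulVec, vecMul_transpose]

/-- One step of the Riccati recursion. -/
noncomputable def riccatiStep (A : Matrix (Fin k) (Fin k) ℝ) (B : Matrix (Fin k) (Fin l) ℝ)
    (C : Matrix (Fin k) (Fin k) ℝ) (E : Matrix (Fin l) (Fin l) ℝ)
    (F : Matrix (Fin k) (Fin k) ℝ) : Matrix (Fin k) (Fin k) ℝ :=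
  C + A.transpose * (F - F * B * (E + B.transpose * F * B)⁻¹ * B.transpose * F) * A

/-- The (negated) optimal feedback gain for the terminal cost `F`. -/
noncomputable def riccatiGain (A : Matrix (Fin k) (Fin k) ℝ) (B : Matrix (Fin k) (Fin l) ℝ)
    (E : Matrix (Fin l) (Fin l) ℝ) (F : Matrix (Fin k) (Fin k) ℝ) : Matrix (Fin l) (Fin k) ℝ :=
  (E + B.transpose * F * B)⁻¹ * (B.transpose * F * A)

variable {A : Matrix (Fin k) (Fin k) ℝ} {B : Matrix (Fin k) (Fin l) ℝ}
  {C : Matrix (Fin k) (Fin k) ℝ} {E : Matrix (Fin l) (Fin l) ℝ} {F : Matrix (Fin k) (Fin k) ℝ}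

theorem posDef_add_congr (hE : E.PosDef) (hF : F.PosSemidef) :
    (E + B.transpose * F * B).PosDef := by
  have := hF.conjTranspose_mul_mul_same B
  rw [conjTranspose_eq_transpose_of_trivial] at this
  exact hE.add_posSemidef this

/-- The excess of a control's cost over the optimum is a square with weight E + BᵀFB, vanishing at u
= -`riccatiGain` x. Any positive semidefinite F is allowed, so this serves both the iterates and the
fixed point. -/
theorem lqr_complete_square (hE : E.PosDef) (hF : F.PosSemidef) (x : Fin k → ℝ) (u : Fin l → ℝ) :
    x ⬝ᵥ C *ᵥ x + u ⬝ᵥ E *ᵥ u + (A *ᵥ x + B *ᵥ u) ⬝ᵥ F *ᵥ (A *ᵥ x + B *ᵥ u) =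
      x ⬝ᵥ riccatiStep A B C E F *ᵥ x +
        (u + riccatiGain A B E F *ᵥ x) ⬝ᵥ
          (E + B.transpose * F * B) *ᵥ (u + riccatiGain A B E F *ᵥ x) := by
  have hS := posDef_add_congr (B := B) hE hF
  set S := E + B.transpose * F * B with hSdef
  set K := riccatiGain A B E F with hK
  have hSK : S * K = Bᵀ * F * A := by
    rw [hK, riccatiGain, ← hSdef, ← Matrix.mul_assoc,
      Matrix.mul_nonsing_inv _ ((Matrix.isUnit_iff_isUnit_det _).1 hS.isUnit), Matrix.one_mul]
  have hric : riccatiStep A B C E F = C + (Aᵀ * F * A - Aᵀ * F * B * K) := by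
    rw [hK, riccatiStep, riccatiGain, ← hSdef]
    simp only [Matrix.mul_sub, Matrix.sub_mul, Matrix.mul_assoc]
  have hFt : Fᵀ = F := (conjTranspose_eq_transpose_of_trivial F).symm.trans hF.1
  have h1 : (A *ᵥ x) ⬝ᵥ F *ᵥ (B *ᵥ u) = u ⬝ᵥ (Bᵀ * F * A) *ᵥ x := by
    rw [dotProduct_mulVec_comm_of_isHermitian hF.1, mulVec_dotProduct, mulVec_mulVec, mulVec_mulVec]
  have h2 : (B *ᵥ u) ⬝ᵥ F *ᵥ (A *ᵥ x) = u ⬝ᵥ (Bᵀ * F * A) *ᵥ x := by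
    rw [mulVec_dotProduct, mulVec_mulVec, mulVec_mulVec]
  have h3 : (A *ᵥ x) ⬝ᵥ F *ᵥ (A *ᵥ x) = x ⬝ᵥ (Aᵀ * F * A) *ᵥ x := by
    rw [mulVec_dotProduct, mulVec_mulVec, mulVec_mulVec]
  have h4 : (B *ᵥ u) ⬝ᵥ F *ᵥ (B *ᵥ u) = u ⬝ᵥ (Bᵀ * F * B) *ᵥ u := by
    rw [mulVec_dotProduct, mulVec_mulVec, mulVec_mulVec]
  have h5 : x ⬝ᵥ (Aᵀ * F * B * K) *ᵥ x = (K *ᵥ x) ⬝ᵥ (Bᵀ * F * A) *ᵥ x := by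
    rw [dotProduct_mulVec (K *ᵥ x), ← mulVec_transpose, dotProduct_comm]
    simp only [transpose_mul, transpose_transpose, hFt, mulVec_mulVec, Matrix.mul_assoc]
  have h6 : u ⬝ᵥ S *ᵥ (K *ᵥ x) = u ⬝ᵥ (Bᵀ * F * A) *ᵥ x := by
    rw [mulVec_mulVec, hSK]
  have h7 : (K *ᵥ x) ⬝ᵥ S *ᵥ u = u ⬝ᵥ (Bᵀ * F * A) *ᵥ x := by
    rw [dotProduct_mulVec_comm_of_isHermitian hS.1, h6]
  have h8 : (K *ᵥ x) ⬝ᵥ S *ᵥ (K *ᵥ x) = (K *ᵥ x) ⬝ᵥ (Bᵀ * F * A) *ᵥ x := by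
    rw [mulVec_mulVec, hSK]
  have h9 : u ⬝ᵥ S *ᵥ u = u ⬝ᵥ E *ᵥ u + u ⬝ᵥ (Bᵀ * F * B) *ᵥ u := by
    rw [hSdef, add_mulVec, dotProduct_add]
  simp only [mulVec_add, add_dotProduct, dotProduct_add, hric, add_mulVec, sub_mulVec,
    dotProduct_sub, h1, h2, h3, h4, h5, h6, h7, h8, h9]
  ring

theorem riccatiStep_le (hE : E.PosDef) (hF : F.PosSemidef) (x : Fin k → ℝ) (u : Fin l → ℝ) :
    x ⬝ᵥ riccatiStep A B C E F *ᵥ x ≤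
    x ⬝ᵥ C *ᵥ x + u ⬝ᵥ E *ᵥ u + (A *ᵥ x + B *ᵥ u) ⬝ᵥ F *ᵥ (A *ᵥ x + B *ᵥ u) := by
  rw [lqr_complete_square hE hF]
  have := (posDef_add_congr (B := B) hE hF).posSemidef.dotProduct_mulVec_nonneg
    (u + riccatiGain A B E F *ᵥ x)
  simp only [star_trivial] at this
  linarith

theorem riccatiStep_eq (hE : E.PosDef) (hF : F.PosSemidef) (x : Fin k → ℝ) :
    x ⬝ᵥ riccatiStep A B C E F *ᵥ x =
    x ⬝ᵥ C *ᵥ x + (-(riccatiGain A B E F *ᵥ x)) ⬝ᵥ E *ᵥ (-(riccatiGain A B E F *ᵥ x)) +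
      (A *ᵥ x + B *ᵥ (-(riccatiGain A B E F *ᵥ x))) ⬝ᵥ
        F *ᵥ (A *ᵥ x + B *ᵥ (-(riccatiGain A B E F *ᵥ x))) := by
  rw [lqr_complete_square hE hF]
  simp

/-- Apply the control optimal for F' to the problem with terminal cost F; it is suboptimal there. -/
theorem riccatiStep_mono (hE : E.PosDef) {F' : Matrix (Fin k) (Fin k) ℝ} (hF : F.PosSemidef)
    (hF' : F'.PosSemidef) (h : ∀ x, x ⬝ᵥ F *ᵥ x ≤ x ⬝ᵥ F' *ᵥ x) (x : Fin k → ℝ) :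
    x ⬝ᵥ riccatiStep A B C E F *ᵥ x ≤ x ⬝ᵥ riccatiStep A B C E F' *ᵥ x := by
  rw [riccatiStep_eq hE hF']
  exact (riccatiStep_le hE hF x _).trans (add_le_add_right (h _) _)

theorem riccatiStep_posSemidef (hC : C.PosDef) (hE : E.PosDef) (hF : F.PosSemidef) :
    (riccatiStep A B C E F).PosSemidef := by
  refine PosSemidef.of_dotProduct_mulVec_nonneg ?_ fun x => ?_
  · have hFt : Fᵀ = F := (conjTranspose_eq_transpose_of_trivial F).symm.trans hF.1
    have hCt : Cᵀ = C := (conjTranspose_eq_transpose_of_trivial C).symm.trans hC.1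
    have hSt : (E + Bᵀ * F * B)ᵀ = E + Bᵀ * F * B :=
      (conjTranspose_eq_transpose_of_trivial _).symm.trans (posDef_add_congr (B := B) hE hF).1
    rw [IsHermitian, conjTranspose_eq_transpose_of_trivial, riccatiStep]
    simp only [transpose_add, transpose_mul, transpose_sub, transpose_transpose,
      transpose_nonsing_inv, hFt, hCt, Matrix.mul_assoc] at hSt ⊢
    rw [hSt]
  · have h1 := hC.posSemidef.dotProduct_mulVec_nonneg x
    have h2 := hE.posSemidef.dotProduct_mulVec_nonneg (-(riccatiGain A B E F *ᵥ x))
    have h3 := hF.dotProduct_mulVec_nonneg (A *ᵥ x + B *ᵥ (-(riccatiGain A B E F *ᵥ x)))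
    simp only [star_trivial] at h1 h2 h3 ⊢
    rw [riccatiStep_eq hE hF]
    linarith

/-- The value iteration started at `0`. -/
noncomputable def riccatiIter (A : Matrix (Fin k) (Fin k) ℝ) (B : Matrix (Fin k) (Fin l) ℝ)
    (C : Matrix (Fin k) (Fin k) ℝ) (E : Matrix (Fin l) (Fin l) ℝ) (j : ℕ) :
    Matrix (Fin k) (Fin k) ℝ :=
  (riccatiStep A B C E)^[j] 0

theorem riccatiIter_succ (j : ℕ) :
    riccatiIter A B C E (j + 1) = riccatiStep A B C E (riccatiIter A B C E j) :=
  Function.iterate_succ_apply' _ _ _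

theorem riccatiIter_posSemidef (hC : C.PosDef) (hE : E.PosDef) (j : ℕ) :
    (riccatiIter A B C E j).PosSemidef := by
  induction j with
  | zero => exact PosSemidef.zero
  | succ j ih => rw [riccatiIter_succ]; exact riccatiStep_posSemidef hC hE ih

/-- The first iterate is at least the start 0, and the monotone step propagates this inequality. -/
theorem riccatiIter_monotone (hC : C.PosDef) (hE : E.PosDef) (x : Fin k → ℝ) :
    Monotone fun j => x ⬝ᵥ riccatiIter A B C E j *ᵥ x := by
  refine monotone_nat_of_le_succ fun j => ?_
  induction j generalizing x with
  | zero =>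
    have := (riccatiIter_posSemidef (A := A) (B := B) hC hE 1).dotProduct_mulVec_nonneg x
    simpa [riccatiIter] using this
  | succ j ih =>
    rw [riccatiIter_succ j, riccatiIter_succ (j + 1)]
    exact riccatiStep_mono hE (riccatiIter_posSemidef hC hE _) (riccatiIter_posSemidef hC hE _) ih x

/-- Polarization: entry (a, b) of a symmetric matrix is recovered from its form at e_a, e_b and e_a
+ e_b. -/
theorem tendsto_matrix_of_tendsto_quadratic {F : ℕ → Matrix (Fin k) (Fin k) ℝ}
    (hF : ∀ j, (F j).IsHermitian)
    (h : ∀ x : Fin k → ℝ, ∃ c, Tendsto (fun j => x ⬝ᵥ F j *ᵥ x) atTop (𝓝 c)) :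
    ∃ G, Tendsto F atTop (𝓝 G) := by
  choose c hc using h
  refine ⟨Matrix.of fun a b => (c (Pi.single a 1 + Pi.single b 1) - c (Pi.single a 1)
    - c (Pi.single b 1)) / 2, ?_⟩
  refine tendsto_pi_nhds.2 fun a => tendsto_pi_nhds.2 fun b => ?_
  have := (((hc (Pi.single a 1 + Pi.single b 1)).sub (hc (Pi.single a 1))).sub
    (hc (Pi.single b 1))).div_const 2
  refine this.congr fun j => ?_
  have hab : F j b a = F j a b := by simpa using (hF j).apply a b
  simp only [mulVec_add, add_dotProduct, dotProduct_add, single_dotProduct, one_mul,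
    mulVec_single_one, col_apply, hab]
  ring

/-- If value iteration stays bounded, it converges to a solution of the Riccati equation. -/
theorem exists_isRiccatiSolution_of_bddAbove (hC : C.PosDef) (hE : E.PosDef)
    (h : ∀ x : Fin k → ℝ, BddAbove (Set.range fun j => x ⬝ᵥ riccatiIter A B C E j *ᵥ x)) :
    ∃ F, IsRiccatiSolution A B C E F := by
  obtain ⟨F, hF⟩ := tendsto_matrix_of_tendsto_quadratic
    (fun j => (riccatiIter_posSemidef (A := A) (B := B) hC hE j).1)
    (fun x => ⟨_, tendsto_atTop_ciSup (riccatiIter_monotone hC hE x) (h x)⟩)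
  have hq : ∀ x : Fin k → ℝ,
      Tendsto (fun j => x ⬝ᵥ riccatiIter A B C E j *ᵥ x) atTop (𝓝 (x ⬝ᵥ F *ᵥ x)) := fun x =>
    ((by fun_prop : Continuous fun G : Matrix (Fin k) (Fin k) ℝ => x ⬝ᵥ G *ᵥ x).tendsto F).comp hF
  have hpos : F.PosSemidef := by
    refine PosSemidef.of_dotProduct_mulVec_nonneg ?_ fun x => ?_
    · have h1 : Tendsto (fun j => (riccatiIter A B C E j)ᴴ) atTop (𝓝 Fᴴ) :=
        ((by fun_prop : Continuous fun G : Matrix (Fin k) (Fin k) ℝ => Gᴴ).tendsto F).comp hF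
      have h2 : (fun j => (riccatiIter A B C E j)ᴴ) = riccatiIter A B C E :=
        funext fun j => (riccatiIter_posSemidef hC hE j).1
      rw [h2] at h1
      exact tendsto_nhds_unique h1 hF
    · refine ge_of_tendsto' (hq x) fun j => ?_
      have := (riccatiIter_posSemidef (A := A) (B := B) hC hE j).dotProduct_mulVec_nonneg x
      simpa using this
  refine ⟨F, hpos, tendsto_nhds_unique ((tendsto_add_atTop_iff_nat 1).2 hF) ?_⟩
  simp_rw [riccatiIter_succ]
  -- The inverse is the only possible discontinuity of the step; positivity of E rules it out at the
  -- limit.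
  have hS : (E + B.transpose * F * B).det ≠ 0 := (posDef_add_congr hE hpos).det_pos.ne'
  have hcont : ContinuousAt (riccatiStep A B C E) F := by
    have hinv : ContinuousAt (fun G => (E + B.transpose * G * B)⁻¹) F := by
      simp only [Matrix.inv_def, Ring.inverse_eq_inv']
      have h1 : ContinuousAt (fun G => (E + B.transpose * G * B).det) F :=
        Continuous.continuousAt (by fun_prop)
      have h2 : ContinuousAt (fun G => (E + B.transpose * G * B).adjugate) F :=
        Continuous.continuousAt (by fun_prop)
      exact (h1.inv₀ hS).smul h2
    unfold riccatiStep
    fun_prop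
  exact hcont.tendsto.comp hF

theorem IsRiccatiSolution.eq_riccatiStep (h : IsRiccatiSolution A B C E F) :
    riccatiStep A B C E F = F := h.2.symm

end Riccati

/-- Positive definite forms dominate the square norm. -/
theorem exists_pos_mul_sq_le_of_posDef {d : ℕ} {G : Matrix (Fin d) (Fin d) ℝ} (hG : G.PosDef) :
    ∃ c, 0 < c ∧ ∀ x : Vec d, c * ‖x‖ ^ 2 ≤ quadForm G x := by
  have hcont : Continuous fun x : Vec d => quadForm G x := by
    unfold quadForm; fun_prop
  -- The sphere is empty only in dimension 0. Otherwise the constant is the minimum of the form on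
  -- it, and homogeneity does the rest.
  rcases (Metric.sphere (0 : Vec d) 1).eq_empty_or_nonempty with hempty | hne
  · refine ⟨1, one_pos, fun x => ?_⟩
    have hx : x = 0 := by
      by_contra hx
      have : ‖x‖⁻¹ • x ∈ Metric.sphere (0 : Vec d) 1 := by
        simp [norm_smul, hx]
      simp [hempty] at this
    simp [hx, quadForm]
  · obtain ⟨y, hy, hmin⟩ := (isCompact_sphere (0 : Vec d) 1).exists_isMinOn hne hcont.continuousOn
    have hy0 : y.ofLp ≠ 0 := by
      intro h
      have : y = 0 := by ext i; simp [h]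
      simp [this] at hy
    refine ⟨quadForm G y, by simpa [quadForm] using hG.dotProduct_mulVec_pos hy0, fun x => ?_⟩
    rcases eq_or_ne x 0 with rfl | hx
    · simp [quadForm]
    have hmem : ‖x‖⁻¹ • x ∈ Metric.sphere (0 : Vec d) 1 := by simp [norm_smul, hx]
    have h1 : quadForm G y ≤ quadForm G (‖x‖⁻¹ • x) := hmin hmem
    have h2 : quadForm G (‖x‖⁻¹ • x) = (‖x‖⁻¹) ^ 2 * quadForm G x := by
      simp [quadForm, mulVec_smul]; ring
    rw [h2] at h1
    have hx' : 0 < ‖x‖ := norm_pos_iff.2 hx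
    calc quadForm G y * ‖x‖ ^ 2 ≤ ((‖x‖⁻¹) ^ 2 * quadForm G x) * ‖x‖ ^ 2 := by gcongr
      _ = quadForm G x := by field_simp

theorem exists_quadForm_le {d : ℕ} (G : Matrix (Fin d) (Fin d) ℝ) :
    ∃ c, 0 < c ∧ ∀ x : Vec d, quadForm G x ≤ c * ‖x‖ ^ 2 := by
  refine ⟨‖toEuclideanCLM (𝕜 := ℝ) G‖ + 1, by positivity, fun x => ?_⟩
  have h1 : quadForm G x = inner ℝ x (toEuclideanCLM (𝕜 := ℝ) G x) := by
    rw [Matrix.inner_toEuclideanCLM]; simp [quadForm]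
  rw [h1]
  calc _ ≤ ‖x‖ * ‖toEuclideanCLM (𝕜 := ℝ) G x‖ := real_inner_le_norm _ _
    _ ≤ ‖x‖ * (‖toEuclideanCLM (𝕜 := ℝ) G‖ * ‖x‖) := by
      gcongr; exact ContinuousLinearMap.le_opNorm _ _
    _ ≤ _ := by nlinarith [sq_nonneg ‖x‖]

/-! ### Geometric decay of the powers of the inverse of an expanding matrix. -/

section Decay

theorem exists_norm_map_le {V W : Type*} [NormedAddCommGroup V] [NormedSpace ℝ V]
    [FiniteDimensional ℝ V] [NormedAddCommGroup W] [NormedSpace ℝ W] (φ : V →ₗ[ℝ] W) :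
    ∃ b, 0 ≤ b ∧ ∀ v, ‖φ v‖ ≤ b * ‖v‖ :=
  ⟨‖LinearMap.toContinuousLinearMap φ‖, norm_nonneg _,
    (LinearMap.toContinuousLinearMap φ).le_opNorm⟩

attribute [local instance] Matrix.linftyOpNormedRing Matrix.linftyOpNormedAlgebra

/-- Gelfand's formula: for r strictly between the spectral radius and 1, the j-th root of ‖a^j‖ is
eventually below r. -/
theorem exists_norm_pow_le_of_spectralRadius_lt_one {𝔸 : Type*} [NormedRing 𝔸] [NormedAlgebra ℂ 𝔸]
    [CompleteSpace 𝔸] (a : 𝔸) (h : spectralRadius ℂ a < 1) :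
    ∃ c ρ : ℝ, 0 ≤ c ∧ 0 ≤ ρ ∧ ρ < 1 ∧ ∀ j : ℕ, ‖a ^ j‖ ≤ c * ρ ^ j := by
  obtain ⟨r, hr1, hr2⟩ := ENNReal.lt_iff_exists_nnreal_btwn.1 h
  have hr2' : r < 1 := by exact_mod_cast hr2
  have hr0 : 0 < r := by
    have : (0 : ℝ≥0∞) < r := bot_le.trans_lt hr1
    exact_mod_cast this
  have hev := (spectrum.pow_nnnorm_pow_one_div_tendsto_nhds_spectralRadius a).eventually_lt_const hr1
  obtain ⟨N, hN⟩ := eventually_atTop.1 hev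
  have hr0' : (0 : ℝ) < r := by exact_mod_cast hr0
  -- The sum absorbs the powers j ≤ N. Cutting at N + 1 makes every remaining j positive, so that
  -- the j-th root can be undone.
  refine ⟨1 + ∑ j ∈ Finset.range (N + 1), ‖a ^ j‖ / (r : ℝ) ^ j, r, by positivity, r.2,
    by exact_mod_cast hr2', fun j => ?_⟩
  rcases lt_or_ge j (N + 1) with hj | hj
  · have h1 : ‖a ^ j‖ / (r : ℝ) ^ j ≤ ∑ j ∈ Finset.range (N + 1), ‖a ^ j‖ / (r : ℝ) ^ j :=
      Finset.single_le_sum (f := fun j => ‖a ^ j‖ / (r : ℝ) ^ j) (fun i _ => by positivity)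
        (Finset.mem_range.2 hj)
    calc ‖a ^ j‖ = ‖a ^ j‖ / (r : ℝ) ^ j * (r : ℝ) ^ j := by field_simp
      _ ≤ _ := by gcongr; linarith
  · have h1 := hN j (by omega)
    have hj0 : (0 : ℝ) < j := by exact_mod_cast (by omega : 0 < j)
    have h2 : (‖a ^ j‖₊ : ℝ≥0∞) ≤ (r : ℝ≥0∞) ^ j := by
      have := ENNReal.rpow_le_rpow h1.le hj0.le
      rwa [← ENNReal.rpow_mul, one_div, inv_mul_cancel₀ hj0.ne', ENNReal.rpow_one,
        ENNReal.rpow_natCast] at this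
    have h3 : ‖a ^ j‖ ≤ (r : ℝ) ^ j := by exact_mod_cast h2
    have h4 : 0 ≤ ∑ j ∈ Finset.range (N + 1), ‖a ^ j‖ / (r : ℝ) ^ j := by positivity
    nlinarith [pow_pos hr0' j]

theorem isUnit_of_one_lt_norm_spectrum {k : ℕ} {A : Matrix (Fin k) (Fin k) ℝ}
    (hA : ∀ z ∈ spectrum ℂ (A.map (algebraMap ℝ ℂ)), 1 < ‖z‖) : IsUnit A.det := by
  have h0 : (0 : ℂ) ∉ spectrum ℂ (A.map (algebraMap ℝ ℂ)) := fun h => by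
    have := hA 0 h; simp at this; linarith
  rw [spectrum.zero_notMem_iff, Matrix.isUnit_iff_isUnit_det] at h0
  have h1 : (A.map (algebraMap ℝ ℂ)).det = algebraMap ℝ ℂ A.det := by
    rw [RingHom.map_det]; rfl
  rw [h1] at h0
  rw [isUnit_iff_ne_zero] at h0 ⊢
  intro h
  simp [h] at h0

/-- Powers of the inverse of an expanding matrix decay geometrically. -/
theorem exists_norm_inv_pow_le {k : ℕ} {A : Matrix (Fin k) (Fin k) ℝ}
    (hA : ∀ z ∈ spectrum ℂ (A.map (algebraMap ℝ ℂ)), 1 < ‖z‖) :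
    ∃ c ρ : ℝ, 0 ≤ c ∧ 0 ≤ ρ ∧ ρ < 1 ∧
      ∀ j : ℕ, ‖(toEuclideanCLM (𝕜 := ℝ) (A⁻¹)ᵀ) ^ j‖ ≤ c * ρ ^ j := by
  have hdet := isUnit_of_one_lt_norm_spectrum hA
  set f : Matrix (Fin k) (Fin k) ℝ →+* Matrix (Fin k) (Fin k) ℂ := (algebraMap ℝ ℂ).mapMatrix
  have hAA : A * A⁻¹ = 1 := Matrix.mul_nonsing_inv _ hdet
  have hAA' : A⁻¹ * A = 1 := Matrix.nonsing_inv_mul _ hdet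
  let a : (Matrix (Fin k) (Fin k) ℂ)ˣ := ⟨f A, f A⁻¹, by rw [← map_mul, hAA, map_one],
    by rw [← map_mul, hAA', map_one]⟩
  have hsr : spectralRadius ℂ (f A⁻¹) < 1 := by
    -- The trivial ring occurs for k = 0, where the spectrum is empty.
    rcases subsingleton_or_nontrivial (Matrix (Fin k) (Fin k) ℂ) with hs | hn
    · simp [spectralRadius]
    · refine spectrum.spectralRadius_lt_of_forall_lt (f A⁻¹) (r := 1) fun z hz => ?_
      have hz0 : z ≠ 0 := by
        rintro rfl
        exact spectrum.zero_notMem ℂ (a⁻¹).isUnit hz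
      have h1 : z⁻¹ ∈ spectrum ℂ (f A) := by
        have := (spectrum.inv₀_mem_iff (R := ℂ) (r := z) (a := a)).2 hz
        exact this
      have h2 := hA _ h1
      rw [norm_inv] at h2
      have h3 : 0 < ‖z‖ := norm_pos_iff.2 hz0
      have h4 : ‖z‖ < 1 := by
        by_contra h
        exact absurd (inv_le_one_of_one_le₀ (not_lt.1 h)) (not_le.2 h2)
      exact_mod_cast h4
  obtain ⟨c, ρ, hc, h0, h1, hb⟩ := exists_norm_pow_le_of_spectralRadius_lt_one (f A⁻¹) hsr
  -- Gelfand's formula was applied over ℂ. Taking real parts, transposing and passing to operators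
  -- is real-linear between finite-dimensional spaces, so the decay transfers at the cost of a
  -- factor b.
  let φ : Matrix (Fin k) (Fin k) ℂ →ₗ[ℝ] (Vec k →L[ℝ] Vec k) :=
    (toEuclideanCLM (n := Fin k) (𝕜 := ℝ)).toAlgEquiv.toLinearMap ∘ₗ
      (Matrix.transposeLinearEquiv (Fin k) (Fin k) ℝ ℝ).toLinearMap ∘ₗ
        (Complex.reLm.mapMatrix)
  obtain ⟨b, hb0, hφ⟩ := exists_norm_map_le φ
  refine ⟨b * c, ρ, by positivity, h0, h1, fun j => ?_⟩
  have h2 : (toEuclideanCLM (𝕜 := ℝ) (A⁻¹)ᵀ) ^ j = φ ((f A⁻¹) ^ j) := by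
    rw [← map_pow, ← map_pow, ← transpose_pow]
    change _ = toEuclideanCLM (𝕜 := ℝ) (((f (A⁻¹ ^ j)).map Complex.re)ᵀ)
    congr 2
  rw [h2]
  calc _ ≤ b * ‖(f A⁻¹) ^ j‖ := hφ _
    _ ≤ b * (c * ρ ^ j) := by gcongr; exact hb j
    _ = _ := by ring

end Decay

/-! ### Trace bounds, Lyapunov functions and boundedness of recursions. -/

open scoped MatrixOrder in
theorem trace_mul_nonneg_of_posSemidef {ι : Type*} [Fintype ι] [DecidableEq ι]
    {P F : Matrix ι ι ℝ} (hP : P.PosSemidef) (hF : F.PosSemidef) : 0 ≤ (P * F).trace := by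
  -- Writing F = NᴴN, cyclicity turns the trace into that of N P Nᴴ.
  obtain ⟨N, rfl⟩ := CStarAlgebra.nonneg_iff_eq_star_mul_self.mp hF.nonneg
  have := (hP.mul_mul_conjTranspose_same N).trace_nonneg
  rwa [Matrix.mul_assoc, Matrix.trace_mul_comm, Matrix.mul_assoc] at this

/-- The trace against a positive definite matrix dominates every evaluation of a positive
semidefinite quadratic form. -/
theorem exists_mul_dotProduct_le_trace_mul {k : ℕ} {Q : Matrix (Fin k) (Fin k) ℝ} (hQ : Q.PosDef)
    (x : Fin k → ℝ) : ∃ c, 0 < c ∧ ∀ F : Matrix (Fin k) (Fin k) ℝ, F.PosSemidef →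
      c * (x ⬝ᵥ F *ᵥ x) ≤ (Q * F).trace := by
  obtain ⟨q, hq, hQq⟩ := exists_pos_mul_sq_le_of_posDef hQ
  have hx : 0 < x ⬝ᵥ x + 1 := by
    have := dotProduct_star_self_nonneg x
    simp only [star_trivial] at this
    linarith
  -- By Cauchy–Schwarz this multiple of x xᵀ lies below q times the identity, hence below Q; the + 1
  -- covers x = 0.
  refine ⟨q / (x ⬝ᵥ x + 1), by positivity, fun F hF => ?_⟩
  have hP : (Q - (q / (x ⬝ᵥ x + 1)) • vecMulVec x x).PosSemidef := by
    refine PosSemidef.of_dotProduct_mulVec_nonneg ?_ fun y => ?_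
    · have h1 : (vecMulVec x x).IsHermitian := by
        simpa using (posSemidef_vecMulVec_self_star x).1
      refine hQ.1.sub ?_
      rw [IsHermitian, conjTranspose_smul, h1]; simp
    · have h1 := hQq (WithLp.toLp 2 y)
      have h2 : ‖WithLp.toLp 2 y‖ ^ 2 = y ⬝ᵥ y := by
        rw [EuclideanSpace.real_norm_sq_eq]; simp [dotProduct, pow_two]
      have h3 : (y ⬝ᵥ x) * (y ⬝ᵥ x) ≤ (x ⬝ᵥ x) * (y ⬝ᵥ y) := by
        have := real_inner_mul_inner_self_le (WithLp.toLp 2 y) (WithLp.toLp 2 x)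
        simp only [EuclideanSpace.inner_toLp_toLp, star_trivial] at this
        rw [dotProduct_comm x y] at this
        linarith
      simp only [quadForm, h2] at h1
      have h4 : (vecMulVec x x) *ᵥ y = (y ⬝ᵥ x) • x := by
        ext i; simp [vecMulVec, mulVec, dotProduct, Finset.sum_mul]
        exact Finset.sum_congr rfl fun j _ => by ring
      simp only [star_trivial, sub_mulVec, smul_mulVec, dotProduct_sub, dotProduct_smul, h4,
        smul_eq_mul]
      have h5 : q / (x ⬝ᵥ x + 1) * ((y ⬝ᵥ x) * (y ⬝ᵥ x)) ≤ q * (y ⬝ᵥ y) := by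
        rw [div_mul_eq_mul_div, div_le_iff₀ hx]
        have : 0 ≤ y ⬝ᵥ y := by rw [← h2]; positivity
        nlinarith
      linarith
  have h := trace_mul_nonneg_of_posSemidef hP hF
  have h6 : (vecMulVec x x * F).trace = x ⬝ᵥ F *ᵥ x := by
    rw [vecMulVec_mul, trace_vecMulVec, dotProduct_mulVec, dotProduct_comm]
  rw [Matrix.sub_mul, Matrix.smul_mul, trace_sub, trace_smul, h6, smul_eq_mul] at h
  linarith

/-- If the averages of the optimal finite-horizon costs stay bounded, the Riccati equation has a
solution. -/
theorem exists_isRiccatiSolution_of_sum_trace_le {k l : ℕ} {A Q : Matrix (Fin k) (Fin k) ℝ}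
    {B : Matrix (Fin k) (Fin l) ℝ} {C : Matrix (Fin k) (Fin k) ℝ} {E : Matrix (Fin l) (Fin l) ℝ}
    (hQ : Q.PosDef) (hC : C.PosDef) (hE : E.PosDef) {c : ℝ}
    (h : ∀ᶠ T : ℕ in atTop,
      ∑ j ∈ Finset.range T, (Q * riccatiIter A B C E j).trace ≤ c * T) :
    ∃ F, IsRiccatiSolution A B C E F := by
  have hpos := fun j => riccatiIter_posSemidef (A := A) (B := B) hC hE j
  have hmono : Monotone fun j => (Q * riccatiIter A B C E j).trace := by
    intro i j hij
    have hsub : (riccatiIter A B C E j - riccatiIter A B C E i).PosSemidef := by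
      refine PosSemidef.of_dotProduct_mulVec_nonneg ((hpos j).1.sub (hpos i).1) fun x => ?_
      have := riccatiIter_monotone (A := A) (B := B) hC hE x hij
      simp only [star_trivial, sub_mulVec, dotProduct_sub] at this ⊢
      linarith
    have := trace_mul_nonneg_of_posSemidef hQ.posSemidef hsub
    rw [Matrix.mul_sub, trace_sub] at this
    simp only
    linarith
  have htr : ∀ j, (Q * riccatiIter A B C E j).trace ≤ 2 * c := by
    obtain ⟨N, hN⟩ := eventually_atTop.1 h
    intro j
    -- Among the first 2M traces, the last M are each at least the M-th one, and the total is at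
    -- most 2cM. The choice M ≥ N makes `h` applicable at 2M, and M ≥ 1 permits division.
    set M := max (max j N) 1 with hM
    have hM1 : (0 : ℝ) < M := by exact_mod_cast lt_of_lt_of_le one_pos (le_max_right _ _)
    have h1 := hN (2 * M) (by omega)
    have h2 : M * (Q * riccatiIter A B C E M).trace ≤
        ∑ j ∈ Finset.range (2 * M), (Q * riccatiIter A B C E j).trace := by
      rw [two_mul, Finset.sum_range_add]
      have h3 : 0 ≤ ∑ j ∈ Finset.range M, (Q * riccatiIter A B C E j).trace :=
        Finset.sum_nonneg fun j _ => trace_mul_nonneg_of_posSemidef hQ.posSemidef (hpos j)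
      have h4 : ∑ i ∈ Finset.range M, (Q * riccatiIter A B C E M).trace ≤
          ∑ i ∈ Finset.range M, (Q * riccatiIter A B C E (M + i)).trace :=
        Finset.sum_le_sum fun i _ => hmono (by omega)
      simp only [Finset.sum_const, Finset.card_range, nsmul_eq_mul] at h4
      linarith
    have h5 : (Q * riccatiIter A B C E M).trace ≤ 2 * c := by
      push_cast at h1
      have : M * (Q * riccatiIter A B C E M).trace ≤ M * (2 * c) := by linarith
      exact le_of_mul_le_mul_left this hM1
    exact (hmono (by omega : j ≤ M)).trans h5
  refine exists_isRiccatiSolution_of_bddAbove hC hE fun x => ?_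
  obtain ⟨q, hq, hx⟩ := exists_mul_dotProduct_le_trace_mul hQ x
  refine ⟨2 * c / q, ?_⟩
  rintro _ ⟨j, rfl⟩
  rw [le_div_iff₀ hq]
  linarith [hx _ (hpos j), htr j]

theorem quadForm_nonneg {d : ℕ} {G : Matrix (Fin d) (Fin d) ℝ} (hG : G.PosSemidef) (x : Vec d) :
    0 ≤ quadForm G x := by
  simpa [quadForm] using hG.dotProduct_mulVec_nonneg x.ofLp

/-- Young's inequality: expand the form at εx - y, which is nonnegative, and divide by ε. -/
theorem quadForm_add_le {d : ℕ} {G : Matrix (Fin d) (Fin d) ℝ} (hG : G.PosSemidef) {ε : ℝ}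
    (hε : 0 < ε) (x y : Vec d) :
    quadForm G (x + y) ≤ (1 + ε) * quadForm G x + (1 + ε⁻¹) * quadForm G y := by
  have h := quadForm_nonneg hG (ε • x - y)
  have hc := dotProduct_mulVec_comm_of_isHermitian hG.1 x.ofLp y.ofLp
  simp only [quadForm, WithLp.ofLp_sub, WithLp.ofLp_smul, WithLp.ofLp_add, mulVec_sub, mulVec_add,
    mulVec_smul, dotProduct_sub, dotProduct_add, sub_dotProduct, add_dotProduct, smul_dotProduct,
    dotProduct_smul, smul_eq_mul] at h ⊢
  rw [← hc] at h ⊢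
  have h2 : 0 ≤ ε⁻¹ * (ε * (ε * x.ofLp ⬝ᵥ G *ᵥ x.ofLp) - ε * x.ofLp ⬝ᵥ G *ᵥ y.ofLp -
      (ε * x.ofLp ⬝ᵥ G *ᵥ y.ofLp - y.ofLp ⬝ᵥ G *ᵥ y.ofLp)) :=
    mul_nonneg (by positivity) (by linarith)
  have h3 : ε⁻¹ * (ε * (ε * x.ofLp ⬝ᵥ G *ᵥ x.ofLp) - ε * x.ofLp ⬝ᵥ G *ᵥ y.ofLp -
      (ε * x.ofLp ⬝ᵥ G *ᵥ y.ofLp - y.ofLp ⬝ᵥ G *ᵥ y.ofLp)) =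
      ε * x.ofLp ⬝ᵥ G *ᵥ x.ofLp - 2 * x.ofLp ⬝ᵥ G *ᵥ y.ofLp +
        ε⁻¹ * y.ofLp ⬝ᵥ G *ᵥ y.ofLp := by
    field_simp; ring
  linarith

/-- A solution of the Riccati equation provides a stabilizing gain with a quadratic Lyapunov
function. -/
theorem IsRiccatiSolution.exists_lyapunov {k l : ℕ} {A : Matrix (Fin k) (Fin k) ℝ}
    {B : Matrix (Fin k) (Fin l) ℝ} {C : Matrix (Fin k) (Fin k) ℝ} {E : Matrix (Fin l) (Fin l) ℝ}
    {F : Matrix (Fin k) (Fin k) ℝ} (hF : IsRiccatiSolution A B C E F) (hC : C.PosDef)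
    (hE : E.PosDef) :
    ∃ (K : Matrix (Fin l) (Fin k) ℝ) (β b c : ℝ), 0 ≤ β ∧ β < 1 ∧ 0 ≤ b ∧ 0 < c ∧
      (∀ x : Vec k, c * ‖x‖ ^ 2 ≤ quadForm F x) ∧
      ∀ x y : Vec k, quadForm F ((A + B * K).toEuclideanLin x + y) ≤
        β * quadForm F x + b * ‖y‖ ^ 2 := by
  obtain ⟨c, hc, hCc⟩ := exists_pos_mul_sq_le_of_posDef hC
  obtain ⟨c', hc', hFc'⟩ := exists_quadForm_le F
  -- Closed-loop form of the Riccati equation: evaluate the Bellman equation at the optimal control.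
  have hstep : ∀ x : Vec k, quadForm F x = quadForm C x +
      quadForm E (WithLp.toLp 2 (-(riccatiGain A B E F *ᵥ x.ofLp))) +
      quadForm F ((A + B * -(riccatiGain A B E F)).toEuclideanLin x) := by
    intro x
    have h := riccatiStep_eq (A := A) (B := B) (C := C) hE hF.1 x.ofLp
    rw [hF.eq_riccatiStep] at h
    have h2 : ((A + B * -(riccatiGain A B E F)).toEuclideanLin x).ofLp =
        A *ᵥ x.ofLp + B *ᵥ (-(riccatiGain A B E F *ᵥ x.ofLp)) := by
      simp [toLpLin_apply, mulVec_neg]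
    simp only [quadForm, h2]
    exact h
  -- F ≤ m and C ≥ c give C ≥ εF, so the closed loop contracts F by 1 - ε. Young's inequality with
  -- the same ε costs a factor 1 + ε, leaving β = 1 - ε². Taking m ≥ c ensures ε ≤ 1.
  set m := max c c' with hm
  have hm0 : 0 < m := hc.trans_le (le_max_left _ _)
  set ε := c / m with hε
  have hε0 : 0 < ε := by positivity
  have hε1 : ε ≤ 1 := (div_le_one hm0).2 (le_max_left _ _)
  refine ⟨-(riccatiGain A B E F), 1 - ε ^ 2, (1 + ε⁻¹) * c', c, by nlinarith, by nlinarith,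
    by positivity, hc, fun x => ?_, fun x y => ?_⟩
  · have h1 := hstep x
    have h2 := quadForm_nonneg hE.posSemidef (WithLp.toLp 2 (-(riccatiGain A B E F *ᵥ x.ofLp)))
    have h3 := quadForm_nonneg hF.1 ((A + B * -(riccatiGain A B E F)).toEuclideanLin x)
    linarith [hCc x]
  · have h1 := hstep x
    have h2 := quadForm_nonneg hE.posSemidef (WithLp.toLp 2 (-(riccatiGain A B E F *ᵥ x.ofLp)))
    have h3 : ε * quadForm F x ≤ c * ‖x‖ ^ 2 := by
      rw [hε, div_mul_eq_mul_div, div_le_iff₀ hm0]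
      have h4 : quadForm F x ≤ m * ‖x‖ ^ 2 :=
        (hFc' x).trans (by gcongr; exact le_max_right _ _)
      nlinarith
    have h5 := hCc x
    calc _ ≤ (1 + ε) * quadForm F ((A + B * -(riccatiGain A B E F)).toEuclideanLin x)
          + (1 + ε⁻¹) * quadForm F y := quadForm_add_le hF.1 hε0 _ _
      _ ≤ (1 + ε) * ((1 - ε) * quadForm F x) + (1 + ε⁻¹) * (c' * ‖y‖ ^ 2) := by
        gcongr
        · linarith
        · exact hFc' y
      _ = _ := by ring

/-- The number b / (1 - β) is the fixed point of v ↦ βv + b. -/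
theorem le_of_affine_recursion {v : ℕ → ℝ} {β b : ℝ} (h0 : 0 ≤ v 0) (hβ0 : 0 ≤ β) (hβ : β < 1)
    (hb : 0 ≤ b) (h : ∀ t, v (t + 1) ≤ β * v t + b) (t : ℕ) : v t ≤ v 0 + b / (1 - β) := by
  have h1 : 0 < 1 - β := by linarith
  have h2 : 0 ≤ b / (1 - β) := by positivity
  induction t with
  | zero => linarith
  | succ t ih =>
    have h3 : b = (1 - β) * (b / (1 - β)) := by field_simp
    have h4 := h t
    nlinarith

/-- A family of quadratic forms with bounded time averages that cannot shrink faster than an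
expanding dynamics allows is uniformly bounded. -/
theorem bounded_of_expanding {k : ℕ} {p : ℕ → Vec k → ℝ} {T : Vec k →L[ℝ] Vec k} {c ρ g D : ℝ}
    (h0 : 0 ≤ ρ) (h1 : ρ < 1) (hg : 0 ≤ g) (hD : 0 ≤ D)
    (hT : ∀ j : ℕ, ‖T ^ j‖ ≤ c * ρ ^ j)
    (hp : ∀ t u, p t u - g * ‖u‖ ^ 2 ≤ p (t + 1) (T u))
    (hgrow : ∀ᶠ t in atTop, ∀ u, p t u ≤ D * t * ‖u‖ ^ 2) (t : ℕ) (u : Vec k) :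
    p t u ≤ g * (c ^ 2 / (1 - ρ ^ 2)) * ‖u‖ ^ 2 := by
  have hTu : ∀ j, ‖(T ^ j) u‖ ^ 2 ≤ c ^ 2 * (ρ ^ 2) ^ j * ‖u‖ ^ 2 := fun j => by
    calc ‖(T ^ j) u‖ ^ 2 ≤ (c * ρ ^ j * ‖u‖) ^ 2 := by
          gcongr
          exact ((T ^ j).le_opNorm u).trans (by gcongr; exact hT j)
      _ = _ := by rw [mul_pow, mul_pow, ← pow_mul, ← pow_mul, mul_comm j 2]
  have hρ2 : ρ ^ 2 < 1 := by nlinarith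
  -- Iterate `hp` along u, Tu, T²u, …; the losses form a geometric series, bounded uniformly in r.
  have hstep : ∀ r, p t u - g * ∑ j ∈ Finset.range r, ‖(T ^ j) u‖ ^ 2 ≤ p (t + r) ((T ^ r) u) := by
    intro r
    induction r with
    | zero => simp
    | succ r ih =>
      have h2 := hp (t + r) ((T ^ r) u)
      rw [Finset.sum_range_succ, pow_succ' T r, ← add_assoc]
      have h3 : (T * T ^ r) u = T ((T ^ r) u) := rfl
      rw [h3]
      linarith
  have hgeom : ∀ r, ∑ j ∈ Finset.range r, ‖(T ^ j) u‖ ^ 2 ≤ c ^ 2 / (1 - ρ ^ 2) * ‖u‖ ^ 2 := by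
    intro r
    calc _ ≤ ∑ j ∈ Finset.range r, c ^ 2 * (ρ ^ 2) ^ j * ‖u‖ ^ 2 :=
          Finset.sum_le_sum fun j _ => hTu j
      _ = c ^ 2 * ‖u‖ ^ 2 * ∑ j ∈ Finset.range r, (ρ ^ 2) ^ j := by
        rw [Finset.mul_sum]; exact Finset.sum_congr rfl fun j _ => by ring
      _ ≤ c ^ 2 * ‖u‖ ^ 2 * (1 - ρ ^ 2)⁻¹ := by
        gcongr
        rw [← tsum_geometric_of_lt_one (by positivity) hρ2]
        exact (summable_geometric_of_lt_one (by positivity) hρ2).sum_le_tsum _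
          fun _ _ => by positivity
      _ = _ := by ring
  -- Linear growth of p in time loses against the geometric decay of T^r u.
  have hlim : Tendsto (fun r : ℕ => D * ((t + r : ℕ) : ℝ) * (c ^ 2 * (ρ ^ 2) ^ r * ‖u‖ ^ 2))
      atTop (𝓝 0) := by
    have h2 := tendsto_self_mul_const_pow_of_lt_one (sq_nonneg ρ) hρ2
    have h3 := tendsto_pow_atTop_nhds_zero_of_lt_one (sq_nonneg ρ) hρ2
    have h4 := ((h3.const_mul (t : ℝ)).add h2).const_mul (D * c ^ 2 * ‖u‖ ^ 2)
    simp only [mul_zero, add_zero] at h4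
    refine h4.congr fun r => ?_
    push_cast
    ring
  have hev : ∀ᶠ r : ℕ in atTop, p t u - g * (c ^ 2 / (1 - ρ ^ 2) * ‖u‖ ^ 2) ≤
      D * ((t + r : ℕ) : ℝ) * (c ^ 2 * (ρ ^ 2) ^ r * ‖u‖ ^ 2) := by
    have h2 : Tendsto (fun r => t + r) atTop atTop :=
    tendsto_atTop_mono (fun r => Nat.le_add_left r t) tendsto_id
    filter_upwards [h2.eventually hgrow] with r hr
    calc _ ≤ p t u - g * ∑ j ∈ Finset.range r, ‖(T ^ j) u‖ ^ 2 := by gcongr; exact hgeom r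
      _ ≤ _ := hstep r
      _ ≤ _ := hr _
      _ ≤ _ := by gcongr; exact hTu r
  have := ge_of_tendsto hlim hev
  linarith

/-! ### Gaussian regression. -/

section Regression

variable {Ω : Type*} [MeasurableSpace Ω] {μ : Measure Ω}

/-- Projection in `L²` onto the linear functionals of a square integrable random vector. -/
theorem exists_dual_orthogonal {F : Type*} [NormedAddCommGroup F]
    [NormedSpace ℝ F] [FiniteDimensional ℝ F] {X : Ω → ℝ} {Y : Ω → F} (hX : MemLp X 2 μ)
    (hY : MemLp Y 2 μ) :
    ∃ π : StrongDual ℝ F, ∀ ψ : StrongDual ℝ F, ∫ ω, (X ω - π (Y ω)) * ψ (Y ω) ∂μ = 0 := by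
  have hm : ∀ φ : StrongDual ℝ F, MemLp (fun ω => φ (Y ω)) 2 μ := fun φ => φ.comp_memLp' hY
  let J : StrongDual ℝ F →ₗ[ℝ] Lp ℝ 2 μ :=
    { toFun := fun φ => (hm φ).toLp _
      map_add' := fun φ ψ => by
        rw [← MemLp.toLp_add]; rfl
      map_smul' := fun a φ => by
        rw [← MemLp.toLp_const_smul]; rfl }
  -- The range of J is finite-dimensional, so the projection exists even if the covariance of Y is
  -- singular; π need not be unique.
  obtain ⟨π, hπ⟩ := (LinearMap.range J).starProjection_apply_mem hX.toLp
  refine ⟨π, fun ψ => ?_⟩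
  have h := (LinearMap.range J).starProjection_inner_eq_zero hX.toLp (J ψ) ⟨ψ, rfl⟩
  rw [← hπ, L2.inner_def] at h
  rw [← h]
  refine integral_congr_ae ?_
  have h1 : (hX.toLp - J π : Lp ℝ 2 μ) =ᵐ[μ] fun ω => X ω - π (Y ω) := by
    filter_upwards [Lp.coeFn_sub hX.toLp (J π), hX.coeFn_toLp, (hm π).coeFn_toLp] with ω h1 h2 h3
    rw [h1, Pi.sub_apply, h2]
    congr 1
  filter_upwards [h1, (hm ψ).coeFn_toLp] with ω h1 h2
  have h3 : (J ψ : Ω → ℝ) ω = ψ (Y ω) := h2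
  rw [h1, h3]
  simp [mul_comm]

variable {F : Type*} [NormedAddCommGroup F] [NormedSpace ℝ F] [FiniteDimensional ℝ F]
  [MeasurableSpace F] [BorelSpace F]

/-- Gaussian regression: for centred jointly Gaussian variables, the conditional expectation is a
linear function of the observation, and the residual is independent of the observation. -/
theorem exists_condExp_eq_linear {k : ℕ} {X : Ω → Vec k} {Y : Ω → F} (hX : Measurable X)
    (hY : Measurable Y)
    (hXY : HasGaussianLaw (fun ω => (X ω, Y ω)) μ) (hX0 : ∫ ω, X ω ∂μ = 0)
    (hY0 : ∫ ω, Y ω ∂μ = 0) :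
    ∃ π : F →L[ℝ] Vec k,
      μ[X | MeasurableSpace.comap Y inferInstance] =ᵐ[μ] (fun ω => π (Y ω)) ∧
      IndepFun (fun ω => X ω - π (Y ω)) Y μ := by
  have := hXY.isProbabilityMeasure
  have hXm : MemLp X 2 μ := hXY.fst.memLp_two
  have hYm : MemLp Y 2 μ := hXY.snd.memLp_two
  have hYi : Integrable Y μ := hYm.integrable (by norm_num)
  have hXc : ∀ i : Fin k, MemLp (fun ω => X ω i) 2 μ := fun i =>
    (EuclideanSpace.proj i : Vec k →L[ℝ] ℝ).comp_memLp' hXm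
  choose p hp using fun i => exists_dual_orthogonal (hXc i) hYm
  set π : F →L[ℝ] Vec k :=
    (EuclideanSpace.equiv (Fin k) ℝ).symm.toContinuousLinearMap ∘L ContinuousLinearMap.pi p
    with hπ
  have hπi : ∀ y i, π y i = p i y := fun _ _ => rfl
  have hπL : MemLp (fun ω => π (Y ω)) 2 μ := π.comp_memLp' hYm
  have hπm : Measurable fun ω => π (Y ω) := π.continuous.measurable.comp hY
  set Z : Ω → Vec k := fun ω => X ω - π (Y ω) with hZ
  have hZm : Measurable Z := hX.sub hπm
  have hZL : MemLp Z 2 μ := hXm.sub hπL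
  have hZ0 : ∫ ω, Z ω ∂μ = 0 := by
    rw [hZ, integral_sub (hXm.integrable (by norm_num)) (hπL.integrable (by norm_num)), hX0,
      π.integral_comp_comm hYi, hY0, map_zero, sub_zero]
  have hZY : HasGaussianLaw (fun ω => (Z ω, Y ω)) μ :=
    hXY.map_fun ((ContinuousLinearMap.fst ℝ (Vec k) F -
      π ∘L ContinuousLinearMap.snd ℝ (Vec k) F).prod (ContinuousLinearMap.snd ℝ (Vec k) F))
  -- For jointly Gaussian vectors it suffices that the covariances vanish, which is the
  -- orthogonality defining each p i, read coordinatewise.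
  have hind : IndepFun Z Y μ := by
    refine hZY.indepFun_of_covariance_strongDual fun L₁ L₂ => ?_
    have hL₁ : MemLp (L₁ ∘ Z) 2 μ := L₁.comp_memLp' hZL
    have hL₂ : MemLp (L₂ ∘ Y) 2 μ := L₂.comp_memLp' hYm
    have h0 : ∫ ω, (L₁ ∘ Z) ω ∂μ = 0 := by
      simp only [Function.comp_apply]
      rw [L₁.integral_comp_comm (hZL.integrable (by norm_num)), hZ0, map_zero]
    have h1 : ∀ ω, (L₁ ∘ Z * L₂ ∘ Y) ω = ∑ i, L₁ (EuclideanSpace.single i 1) *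
        ((X ω i - p i (Y ω)) * L₂ (Y ω)) := fun ω => by
      have h2 : Z ω = ∑ i, Z ω i • EuclideanSpace.single i (1 : ℝ) := by
        ext j
        simp [Finset.sum_apply, Pi.single_apply]
      rw [Pi.mul_apply, Function.comp_apply, h2, map_sum, Finset.sum_mul]
      refine Finset.sum_congr rfl fun i _ => ?_
      rw [map_smul, hZ, PiLp.sub_apply, hπi]
      simp only [smul_eq_mul, Function.comp_apply]
      ring
    have h3 : ∀ i : Fin k, Integrable (fun ω => (X ω i - p i (Y ω)) * L₂ (Y ω)) μ := fun i =>
      ((hXc i).sub ((p i).comp_memLp' hYm)).integrable_mul hL₂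
    rw [covariance_eq_sub hL₁ hL₂, h0, zero_mul, sub_zero]
    simp_rw [h1]
    rw [integral_finsetSum _ fun i _ => (h3 i).const_mul _]
    refine Finset.sum_eq_zero fun i _ => ?_
    rw [integral_const_mul, hp, mul_zero]
  refine ⟨π, ?_, hind⟩
  have hle : MeasurableSpace.comap Y inferInstance ≤ (inferInstance : MeasurableSpace Ω) :=
    hY.comap_le
  have hc : μ[Z | MeasurableSpace.comap Y inferInstance] =ᵐ[μ] fun _ => 0 := by
    have h1 := condExp_indep_eq (μ := μ) hZm.comap_le hle
      (comap_measurable Z).stronglyMeasurable hind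
    filter_upwards [h1] with ω h
    rw [h, hZ0]
  have hXe : X = Z + fun ω => π (Y ω) := by funext ω; simp [hZ]
  have hadd := condExp_add (hZL.integrable (by norm_num)) (hπL.integrable (by norm_num))
    (MeasurableSpace.comap Y inferInstance)
  rw [← hXe] at hadd
  have hself : μ[fun ω => π (Y ω) | MeasurableSpace.comap Y inferInstance] = fun ω => π (Y ω) :=
    condExp_of_stronglyMeasurable hle
      (π.continuous.measurable.comp (comap_measurable Y)).stronglyMeasurable
      (hπL.integrable (by norm_num))
  rw [hself] at hadd
  filter_upwards [hadd, hc] with ω h1 h2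
  rw [h1, Pi.add_apply, h2, zero_add]

end Regression

/-- Up to reassociation, both joint laws are the product of the three marginals. -/
theorem indepFun_prodMk_left {Ω α β γ : Type*} [MeasurableSpace Ω] {μ : Measure Ω}
    [IsProbabilityMeasure μ] [MeasurableSpace α] [MeasurableSpace β] [MeasurableSpace γ]
    {X : Ω → α} {Y : Ω → β} {Z : Ω → γ} (hX : Measurable X) (hY : Measurable Y) (hZ : Measurable Z)
    (h1 : IndepFun X (fun ω => (Y ω, Z ω)) μ) (h2 : IndepFun Y Z μ) :
    IndepFun (fun ω => (X ω, Y ω)) Z μ := by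
  have : IsProbabilityMeasure (μ.map X) := Measure.isProbabilityMeasure_map hX.aemeasurable
  have : IsProbabilityMeasure (μ.map Y) := Measure.isProbabilityMeasure_map hY.aemeasurable
  have : IsProbabilityMeasure (μ.map Z) := Measure.isProbabilityMeasure_map hZ.aemeasurable
  have h3 : IndepFun X Y μ := h1.comp measurable_id measurable_fst
  rw [indepFun_iff_map_prod_eq_prod_map_map (by fun_prop) (by fun_prop)] at h1 h2 h3 ⊢
  apply MeasurableEquiv.prodAssoc.map_measurableEquiv_injective
  rw [h3, Measure.prodAssoc_prod, ← h2, ← h1, Measure.map_map (by fun_prop) (by fun_prop)]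
  rfl

/-- The components of a pair whose law is a product are independent with the factors as laws. -/
theorem hasLaw_and_indepFun_of_hasLaw_prod {Ω α β : Type*} [MeasurableSpace Ω] {μ : Measure Ω}
    [IsProbabilityMeasure μ] [MeasurableSpace α] [MeasurableSpace β] {X : Ω → α} {Y : Ω → β}
    {ν : Measure α} {τ : Measure β} [IsProbabilityMeasure ν] [IsProbabilityMeasure τ]
    (h : HasLaw (fun ω => (X ω, Y ω)) (ν.prod τ) μ) :
    HasLaw X ν μ ∧ HasLaw Y τ μ ∧ IndepFun X Y μ := by
  have hX : AEMeasurable X μ := h.aemeasurable.fst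
  have hY : AEMeasurable Y μ := h.aemeasurable.snd
  have h1 : μ.map X = ν := by
    have := Measure.map_fst_prod (μ := ν) (ν := τ)
    rw [← h.map_eq, AEMeasurable.map_map_of_aemeasurable measurable_fst.aemeasurable
      h.aemeasurable, measure_univ, one_smul] at this
    exact this
  have h2 : μ.map Y = τ := by
    have := Measure.map_snd_prod (μ := ν) (ν := τ)
    rw [← h.map_eq, AEMeasurable.map_map_of_aemeasurable measurable_snd.aemeasurable
      h.aemeasurable, measure_univ, one_smul] at this
    exact this
  refine ⟨⟨hX, h1⟩, ⟨hY, h2⟩, ?_⟩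
  rw [indepFun_iff_map_prod_eq_prod_map_map hX hY, h1, h2]
  exact h.map_eq

/-- `f` agrees almost everywhere with a continuous linear function of `ξ`. -/
def IsLinearOf {Ω E F : Type*} [MeasurableSpace Ω] (μ : Measure Ω) [NormedAddCommGroup E]
    [NormedSpace ℝ E] [NormedAddCommGroup F] [NormedSpace ℝ F] (ξ : Ω → E) (f : Ω → F) : Prop :=
  ∃ Φ : E →L[ℝ] F, f =ᵐ[μ] fun ω => Φ (ξ ω)

/-! ### Calculus of almost sure linear dependence. -/

namespace IsLinearOf

variable {Ω E F G : Type*} [MeasurableSpace Ω] {μ : Measure Ω} [NormedAddCommGroup E]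
  [NormedSpace ℝ E] [NormedAddCommGroup F] [NormedSpace ℝ F] [NormedAddCommGroup G]
  [NormedSpace ℝ G] {ξ : Ω → E} {f g : Ω → F}

theorem comp (hf : IsLinearOf μ ξ f) (L : F →L[ℝ] G) : IsLinearOf μ ξ fun ω => L (f ω) := by
  obtain ⟨Φ, hΦ⟩ := hf
  exact ⟨L ∘L Φ, by filter_upwards [hΦ] with ω h; simp [h]⟩

theorem congr (hf : IsLinearOf μ ξ f) (h : g =ᵐ[μ] f) : IsLinearOf μ ξ g := by
  obtain ⟨Φ, hΦ⟩ := hf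
  exact ⟨Φ, h.trans hΦ⟩

theorem add (hf : IsLinearOf μ ξ f) (hg : IsLinearOf μ ξ g) :
    IsLinearOf μ ξ fun ω => f ω + g ω := by
  obtain ⟨Φ, hΦ⟩ := hf
  obtain ⟨Ψ, hΨ⟩ := hg
  exact ⟨Φ + Ψ, by filter_upwards [hΦ, hΨ] with ω h1 h2; simp [h1, h2]⟩

theorem sub (hf : IsLinearOf μ ξ f) (hg : IsLinearOf μ ξ g) :
    IsLinearOf μ ξ fun ω => f ω - g ω := by
  obtain ⟨Φ, hΦ⟩ := hf
  obtain ⟨Ψ, hΨ⟩ := hg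
  exact ⟨Φ - Ψ, by filter_upwards [hΦ, hΨ] with ω h1 h2; simp [h1, h2]⟩

theorem prodMk {g : Ω → G} (hf : IsLinearOf μ ξ f) (hg : IsLinearOf μ ξ g) :
    IsLinearOf μ ξ fun ω => (f ω, g ω) := by
  obtain ⟨Φ, hΦ⟩ := hf
  obtain ⟨Ψ, hΨ⟩ := hg
  exact ⟨Φ.prod Ψ, by filter_upwards [hΦ, hΨ] with ω h1 h2; simp [h1, h2]⟩

theorem pi {ι : Type*} [Fintype ι] {f : ι → Ω → F} (hf : ∀ i, IsLinearOf μ ξ (f i)) :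
    IsLinearOf μ ξ fun ω i => f i ω := by
  choose Φ hΦ using hf
  refine ⟨ContinuousLinearMap.pi Φ, ?_⟩
  filter_upwards [eventually_all.2 hΦ] with ω h
  ext i
  simpa using h i

theorem trans {η : Ω → G} (hf : IsLinearOf μ ξ f) (hξ : IsLinearOf μ η ξ) : IsLinearOf μ η f := by
  obtain ⟨Φ, hΦ⟩ := hf
  obtain ⟨Ψ, hΨ⟩ := hξ
  exact ⟨Φ ∘L Ψ, by filter_upwards [hΦ, hΨ] with ω h1 h2; simp [h1, h2]⟩

variable [MeasurableSpace E] [BorelSpace E] [SecondCountableTopology E]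
  [MeasurableSpace F] [BorelSpace F] [SecondCountableTopology F]

theorem hasGaussianLaw (hf : IsLinearOf μ ξ f) (hξ : HasGaussianLaw ξ μ) :
    HasGaussianLaw f μ := by
  obtain ⟨Φ, hΦ⟩ := hf
  exact (hξ.map_fun Φ).congr hΦ.symm

theorem integral_eq_zero [CompleteSpace E] [CompleteSpace F] (hf : IsLinearOf μ ξ f)
    (hξ : HasGaussianLaw ξ μ) (h0 : ∫ ω, ξ ω ∂μ = 0) : ∫ ω, f ω ∂μ = 0 := by
  obtain ⟨Φ, hΦ⟩ := hf
  rw [integral_congr_ae hΦ, Φ.integral_comp_comm hξ.integrable, h0, map_zero]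

theorem indepFun {N : Ω → G} [MeasurableSpace G] (hf : IsLinearOf μ ξ f) (h : IndepFun ξ N μ) :
    IndepFun f N μ := by
  obtain ⟨Φ, hΦ⟩ := hf
  exact (h.comp Φ.continuous.measurable measurable_id).congr hΦ.symm EventuallyEq.rfl

end IsLinearOf

/-! ### Joint Gaussianity of states and outputs. -/

namespace CodedSystem

variable {Ω : Type} [MeasurableSpace Ω] {μ : Measure Ω} [IsProbabilityMeasure μ] {k m n : ℕ}
  {A Q : Matrix (Fin k) (Fin k) ℝ} {H : Matrix (Fin m) (Fin n) ℝ} {R : Matrix (Fin m) (Fin m) ℝ}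
  {V : ℕ → Ω → Vec k} (sys : CodedSystem μ A Q H R V)

/-- The three noises at time `t`. -/
def noise (t : ℕ) (ω : Ω) : Vec k × Vec m × Vec n := (sys.W t ω, sys.Z t ω, sys.M t ω)

/-- The initial state and the noises before time `t`. -/
def driver (t : ℕ) (ω : Ω) : Vec k × (Fin t → Vec k × Vec m × Vec n) :=
  (sys.S 0 ω, fun i => sys.noise i ω)

theorem measurable_noise (t : ℕ) : Measurable (sys.noise t) :=
  (sys.measurable_W t).prodMk ((sys.measurable_Z t).prodMk (sys.measurable_M t))

theorem hasGaussianLaw_noise (t : ℕ) : HasGaussianLaw (sys.noise t) μ :=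
  (sys.law_noise t).hasGaussianLaw

theorem hasGaussianLaw_init : HasGaussianLaw (sys.S 0) μ := sys.law_init.hasGaussianLaw

theorem hasGaussianLaw_driver (t : ℕ) : HasGaussianLaw (sys.driver t) μ := by
  refine IndepFun.hasGaussianLaw sys.hasGaussianLaw_init ?_ ?_
  · exact (sys.indep_noise.precomp (g := fun i : Fin t => (i : ℕ))
      Fin.val_injective).hasGaussianLaw fun i => sys.hasGaussianLaw_noise i
  · exact sys.indep_init.comp (φ := id) (ψ := fun x (i : Fin t) => x i) measurable_id
      (by fun_prop)

theorem indepFun_driver_noise (t : ℕ) : IndepFun (sys.driver t) (sys.noise t) μ := by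
  have hm : Measurable fun ω (i : Fin t) => sys.noise i ω :=
    measurable_pi_lambda _ fun i => sys.measurable_noise i
  refine indepFun_prodMk_left (sys.measurable_S 0) hm (sys.measurable_noise t) ?_ ?_
  · exact sys.indep_init.comp (φ := id) (ψ := fun x => ((fun i : Fin t => x i), x t))
      measurable_id (by fun_prop)
  · have h := sys.indep_noise.indepFun_finset (Finset.range t) {t} (by simp)
      sys.measurable_noise
    have hφ : Measurable fun (x : Finset.range t → Vec k × Vec m × Vec n) (i : Fin t) =>
        x ⟨i, Finset.mem_range.2 i.2⟩ := by fun_prop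
    have hψ : Measurable fun x : ({t} : Finset ℕ) → Vec k × Vec m × Vec n =>
        x ⟨t, Finset.mem_singleton_self t⟩ := measurable_pi_apply _
    exact h.comp hφ hψ

theorem hasLaw_W (t : ℕ) : HasLaw (sys.W t) (multivariateGaussian 0 Q) μ :=
  (hasLaw_and_indepFun_of_hasLaw_prod (sys.law_noise t)).1

theorem hasLaw_Z_M (t : ℕ) : HasLaw (fun ω => (sys.Z t ω, sys.M t ω))
    ((multivariateGaussian 0 R).prod (multivariateGaussian 0 sys.Θ)) μ :=
  (hasLaw_and_indepFun_of_hasLaw_prod (sys.law_noise t)).2.1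

theorem hasLaw_Z (t : ℕ) : HasLaw (sys.Z t) (multivariateGaussian 0 R) μ :=
  (hasLaw_and_indepFun_of_hasLaw_prod (sys.hasLaw_Z_M t)).1

theorem hasLaw_M (t : ℕ) : HasLaw (sys.M t) (multivariateGaussian 0 sys.Θ) μ :=
  (hasLaw_and_indepFun_of_hasLaw_prod (sys.hasLaw_Z_M t)).2.1

theorem indepFun_W_Z_M (t : ℕ) :
    IndepFun (sys.W t) (fun ω => (sys.Z t ω, sys.M t ω)) μ :=
  (hasLaw_and_indepFun_of_hasLaw_prod (sys.law_noise t)).2.2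

theorem indepFun_Z_M (t : ℕ) : IndepFun (sys.Z t) (sys.M t) μ :=
  (hasLaw_and_indepFun_of_hasLaw_prod (sys.hasLaw_Z_M t)).2.2

theorem integral_eq_zero_of_hasLaw {d : ℕ} {f : Ω → Vec d} {G : Matrix (Fin d) (Fin d) ℝ}
    (hf : HasLaw f (multivariateGaussian 0 G) μ) : ∫ ω, f ω ∂μ = 0 := by
  rw [hf.integral_eq, integral_id_multivariateGaussian]

theorem integral_noise (t : ℕ) : ∫ ω, sys.noise t ω ∂μ = 0 := by
  have hW := integral_eq_zero_of_hasLaw (sys.hasLaw_W t)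
  have hZ := integral_eq_zero_of_hasLaw (sys.hasLaw_Z t)
  have hM := integral_eq_zero_of_hasLaw (sys.hasLaw_M t)
  have h1 := (sys.hasLaw_W t).hasGaussianLaw.integrable
  have h2 := (sys.hasLaw_Z t).hasGaussianLaw.integrable
  have h3 := (sys.hasLaw_M t).hasGaussianLaw.integrable
  simp only [noise]
  rw [integral_pair h1 (h2.prodMk h3), integral_pair h2 h3, hW, hZ, hM]
  rfl

theorem integral_driver (t : ℕ) : ∫ ω, sys.driver t ω ∂μ = 0 := by
  have h1 := sys.hasGaussianLaw_init.integrable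
  have h2 : ∀ i : Fin t, Integrable (fun ω => sys.noise i ω) μ := fun i =>
    (sys.hasGaussianLaw_noise i).integrable
  simp only [driver]
  rw [integral_pair h1 (Integrable.of_eval h2), integral_eq_zero_of_hasLaw sys.law_init,
    Prod.mk_eq_zero]
  refine ⟨rfl, ?_⟩
  ext1 i
  rw [eval_integral h2]
  exact sys.integral_noise i

theorem isLinearOf_driver_succ (t : ℕ) :
    IsLinearOf μ (sys.driver (t + 1)) (sys.driver t) :=
  ⟨(ContinuousLinearMap.fst ℝ _ _).prod
    ((ContinuousLinearMap.pi fun i : Fin t => ContinuousLinearMap.proj i.castSucc) ∘L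
      ContinuousLinearMap.snd ℝ _ _), .of_forall fun _ => rfl⟩

theorem isLinearOf_noise (t : ℕ) : IsLinearOf μ (sys.driver (t + 1)) (sys.noise t) :=
  ⟨ContinuousLinearMap.proj (Fin.last t) ∘L ContinuousLinearMap.snd ℝ _ _,
    .of_forall fun _ => rfl⟩

theorem isLinearOf_W (t : ℕ) : IsLinearOf μ (sys.driver (t + 1)) (sys.W t) :=
  (sys.isLinearOf_noise t).comp (ContinuousLinearMap.fst ℝ _ _)

theorem isLinearOf_Z (t : ℕ) : IsLinearOf μ (sys.driver (t + 1)) (sys.Z t) :=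
  (sys.isLinearOf_noise t).comp (ContinuousLinearMap.fst ℝ _ _ ∘L ContinuousLinearMap.snd ℝ _ _)

theorem isLinearOf_M (t : ℕ) : IsLinearOf μ (sys.driver (t + 1)) (sys.M t) :=
  (sys.isLinearOf_noise t).comp (ContinuousLinearMap.snd ℝ _ _ ∘L ContinuousLinearMap.snd ℝ _ _)

theorem measurable_past (t : ℕ) : Measurable (past sys.Y t) :=
  measurable_pi_lambda _ fun i => sys.measurable_Y i

/-- The input process is a linear function of the past channel outputs. -/
def HasLinearInput : Prop :=
  ∀ t, ∃ v : (Fin t → Vec m) →ₗ[ℝ] Vec k, ∀ ω, V t ω = v (past sys.Y t ω)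

variable {sys}

theorem exists_predictor_eq {t : ℕ} (hS : IsLinearOf μ (sys.driver t) (sys.S t))
    (hY : IsLinearOf μ (sys.driver t) (past sys.Y t)) :
    ∃ π : (Fin t → Vec m) →L[ℝ] Vec k,
      predictor μ sys.S sys.Y t =ᵐ[μ] (fun ω => π (past sys.Y t ω)) ∧
      IndepFun (fun ω => sys.S t ω - π (past sys.Y t ω)) (past sys.Y t) μ :=
  exists_condExp_eq_linear (sys.measurable_S t) (sys.measurable_past t)
    ((hS.prodMk hY).hasGaussianLaw (sys.hasGaussianLaw_driver t))
    (hS.integral_eq_zero (sys.hasGaussianLaw_driver t) (sys.integral_driver t))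
    (hY.integral_eq_zero (sys.hasGaussianLaw_driver t) (sys.integral_driver t))

theorem isLinearOf_predError {t : ℕ} (hS : IsLinearOf μ (sys.driver t) (sys.S t))
    (hY : IsLinearOf μ (sys.driver t) (past sys.Y t)) :
    IsLinearOf μ (sys.driver t) (predError μ sys.S sys.Y t) := by
  obtain ⟨π, hπ, -⟩ := exists_predictor_eq hS hY
  exact hS.sub ((hY.comp π).congr hπ)

theorem isLinearOf_Y_of_past {t : ℕ} (hS : IsLinearOf μ (sys.driver t) (sys.S t))
    (hY : IsLinearOf μ (sys.driver t) (past sys.Y t)) :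
    IsLinearOf μ (sys.driver (t + 1)) (sys.Y t) := by
  have h1 := ((isLinearOf_predError hS hY).trans (sys.isLinearOf_driver_succ t)).comp
    (LinearMap.toContinuousLinearMap
      (sys.Γ * (errorCov μ sys.S sys.Y t)⁻¹).toEuclideanLin)
  have h2 : IsLinearOf μ (sys.driver (t + 1)) (sys.X t) :=
    (h1.add (sys.isLinearOf_M t)).congr (sys.encoder_eq t)
  refine ((h2.comp (LinearMap.toContinuousLinearMap H.toEuclideanLin)).add
    (sys.isLinearOf_Z t)).congr (.of_forall fun ω => ?_)
  exact sys.channel_eq t ω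

/-- State and outputs need a common induction: the next output contains the predictor, which is
linear in the past only because S_t and the past outputs are already jointly Gaussian. -/
theorem HasLinearInput.isLinearOf (hV : sys.HasLinearInput) (t : ℕ) :
    IsLinearOf μ (sys.driver t) (sys.S t) ∧ IsLinearOf μ (sys.driver t) (past sys.Y t) := by
  induction t with
  | zero =>
    refine ⟨⟨ContinuousLinearMap.fst ℝ _ _, .of_forall fun _ => rfl⟩, ⟨0, .of_forall fun ω => ?_⟩⟩
    exact Subsingleton.elim _ _
  | succ t ih =>
    have hY := isLinearOf_Y_of_past ih.1 ih.2
    obtain ⟨v, hv⟩ := hV t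
    have hS' := ih.1.trans (sys.isLinearOf_driver_succ t)
    have hY' := ih.2.trans (sys.isLinearOf_driver_succ t)
    constructor
    · refine (((hS'.comp (LinearMap.toContinuousLinearMap A.toEuclideanLin)).add
        (hY'.comp (LinearMap.toContinuousLinearMap v))).add (sys.isLinearOf_W t)).congr
        (.of_forall fun ω => ?_)
      rw [sys.state_eq t ω, hv]
      rfl
    · refine IsLinearOf.pi fun i => ?_
      refine Fin.lastCases hY (fun j => ?_) i
      exact hY'.comp (ContinuousLinearMap.proj j)

end CodedSystem

/-! ### Second moments of random vectors. -/

section Moments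

variable {Ω : Type} [MeasurableSpace Ω] {μ : Measure Ω} [IsProbabilityMeasure μ] {d : ℕ}

theorem quadForm_eq_inner (G : Matrix (Fin d) (Fin d) ℝ) (x : Vec d) :
    quadForm G x = inner ℝ x (toEuclideanCLM (𝕜 := ℝ) G x) := by
  rw [Matrix.inner_toEuclideanCLM]; simp [quadForm]

theorem integrable_inner_of_memLp {f g : Ω → Vec d} (hf : MemLp f 2 μ) (hg : MemLp g 2 μ) :
    Integrable (fun ω => inner ℝ (f ω) (g ω)) μ := by
  have h := (hf.norm.integrable_mul hg.norm)
  refine h.mono (hf.1.inner hg.1) (.of_forall fun ω => ?_)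
  simpa using norm_inner_le_norm (𝕜 := ℝ) (f ω) (g ω)

theorem integrable_quadForm (G : Matrix (Fin d) (Fin d) ℝ) {f : Ω → Vec d} (hf : MemLp f 2 μ) :
    Integrable (fun ω => quadForm G (f ω)) μ := by
  simp_rw [quadForm_eq_inner]
  exact integrable_inner_of_memLp hf ((toEuclideanCLM (𝕜 := ℝ) G).comp_memLp' hf)

theorem integrable_sq_norm {f : Ω → Vec d} (hf : MemLp f 2 μ) :
    Integrable (fun ω => ‖f ω‖ ^ 2) μ := by
  simpa using integrable_inner_of_memLp hf hf

/-- Adding an independent centred vector adds the expected quadratic forms. -/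
theorem integral_quadForm_add_of_indepFun (G : Matrix (Fin d) (Fin d) ℝ) {f w : Ω → Vec d}
    (hf : MemLp f 2 μ) (hw : MemLp w 2 μ) (h : IndepFun f w μ) (h0 : ∫ ω, w ω ∂μ = 0) :
    ∫ ω, quadForm G (f ω + w ω) ∂μ = ∫ ω, quadForm G (f ω) ∂μ + ∫ ω, quadForm G (w ω) ∂μ := by
  set T := toEuclideanCLM (𝕜 := ℝ) G with hT
  have hTf := T.comp_memLp' hf
  have hTw := T.comp_memLp' hw
  have hfi := hf.integrable (q := 2) (by norm_num)
  have hwi := hw.integrable (q := 2) (by norm_num)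
  have h1 : ∫ ω, inner ℝ (f ω) (T (w ω)) ∂μ = 0 := by
    have h2 : IndepFun f (fun ω => T (w ω)) μ := h.comp measurable_id T.continuous.measurable
    have h3 := h2.integral_bilin hfi (hTw.integrable (by norm_num)) (innerSL ℝ)
    rw [T.integral_comp_comm hwi, h0, map_zero, map_zero] at h3
    exact h3
  have h1' : ∫ ω, inner ℝ (w ω) (T (f ω)) ∂μ = 0 := by
    have h2 : IndepFun w (fun ω => T (f ω)) μ := h.symm.comp measurable_id T.continuous.measurable
    have h3 := h2.integral_bilin hwi (hTf.integrable (by norm_num)) (innerSL ℝ)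
    rw [h0, map_zero, _root_.zero_apply] at h3
    exact h3
  have h4 : ∀ ω, quadForm G (f ω + w ω) = quadForm G (f ω) + quadForm G (w ω) +
      (inner ℝ (f ω) (T (w ω)) + inner ℝ (w ω) (T (f ω))) := fun ω => by
    simp only [quadForm_eq_inner, ← hT, map_add, inner_add_left, inner_add_right]
    ring
  simp_rw [h4]
  have i1 := integrable_quadForm G hf
  have i2 := integrable_quadForm G hw
  have i3 : Integrable (fun ω => inner ℝ (f ω) (T (w ω))) μ := integrable_inner_of_memLp hf hTw
  have i4 : Integrable (fun ω => inner ℝ (w ω) (T (f ω))) μ := integrable_inner_of_memLp hw hTf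
  have i12 : Integrable (fun ω => quadForm G (f ω) + quadForm G (w ω)) μ := i1.add i2
  have i34 : Integrable (fun ω => inner ℝ (f ω) (T (w ω)) + inner ℝ (w ω) (T (f ω))) μ :=
    i3.add i4
  rw [integral_add i12 i34, integral_add i1 i2, integral_add i3 i4, h1, h1']
  ring

theorem quadForm_one (x : Vec d) : quadForm 1 x = ‖x‖ ^ 2 := by
  rw [quadForm_eq_inner]; simp

theorem integral_sq_norm_add_of_indepFun {f w : Ω → Vec d} (hf : MemLp f 2 μ) (hw : MemLp w 2 μ)
    (h : IndepFun f w μ) (h0 : ∫ ω, w ω ∂μ = 0) :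
    ∫ ω, ‖f ω + w ω‖ ^ 2 ∂μ = ∫ ω, ‖f ω‖ ^ 2 ∂μ + ∫ ω, ‖w ω‖ ^ 2 ∂μ := by
  simpa only [quadForm_one] using integral_quadForm_add_of_indepFun 1 hf hw h h0

theorem integral_sq_add_of_indepFun {f w : Ω → ℝ} (hf : MemLp f 2 μ) (hw : MemLp w 2 μ)
    (h : IndepFun f w μ) (h0 : ∫ ω, w ω ∂μ = 0) :
    ∫ ω, (f ω + w ω) ^ 2 ∂μ = ∫ ω, f ω ^ 2 ∂μ + ∫ ω, w ω ^ 2 ∂μ := by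
  have h1 : ∫ ω, f ω * w ω ∂μ = 0 := by
    rw [h.integral_fun_mul_eq_mul_integral hf.1 hw.1, h0, mul_zero]
  have h2 : ∀ ω, (f ω + w ω) ^ 2 = f ω ^ 2 + w ω ^ 2 + 2 * (f ω * w ω) := fun ω => by ring
  simp_rw [h2]
  have i1 : Integrable (fun ω => f ω ^ 2 + w ω ^ 2) μ := hf.integrable_sq.add hw.integrable_sq
  have i2 : Integrable (fun ω => 2 * (f ω * w ω)) μ := (hf.integrable_mul hw).const_mul 2
  rw [integral_add i1 i2, integral_add hf.integrable_sq hw.integrable_sq, integral_const_mul, h1]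
  ring

theorem integral_quadForm_of_hasLaw {Q G : Matrix (Fin d) (Fin d) ℝ} (hQ : Q.PosSemidef)
    {w : Ω → Vec d} (hw : HasLaw w (multivariateGaussian 0 Q) μ) :
    ∫ ω, quadForm G (w ω) ∂μ = (Q * G).trace := by
  have h1 := hw.integral_comp (f := quadForm G) (by
    unfold quadForm
    exact Continuous.aestronglyMeasurable (by fun_prop))
  simp only [Function.comp_def] at h1
  rw [h1]
  have hm : ∀ i : Fin d, MemLp (fun x : Vec d => x i) 2 (multivariateGaussian 0 Q) := fun i =>
    (EuclideanSpace.proj i : Vec d →L[ℝ] ℝ).comp_memLp' IsGaussian.memLp_two_id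
  have hz : ∀ i : Fin d, ∫ x : Vec d, x i ∂(multivariateGaussian 0 Q) = 0 := fun i => by
    have := (EuclideanSpace.proj i : Vec d →L[ℝ] ℝ).integral_comp_comm
      (IsGaussian.integrable_id (μ := multivariateGaussian (0 : Vec d) Q))
    simpa using this
  have h2 : ∀ x : Vec d, quadForm G x = ∑ i, ∑ j, G i j * (x i * x j) := fun x => by
    simp only [quadForm, dotProduct, mulVec, Finset.mul_sum]
    exact Finset.sum_congr rfl fun i _ => Finset.sum_congr rfl fun j _ => by ring
  have h3 : ∀ i j : Fin d, ∫ x : Vec d, x i * x j ∂(multivariateGaussian 0 Q) = Q i j :=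
    fun i j => by
      have := covariance_eval_multivariateGaussian (μ := (0 : Vec d)) hQ i j
      rw [covariance_eq_sub (hm i) (hm j), hz, zero_mul, sub_zero] at this
      exact this
  have hint : ∀ i j : Fin d,
      Integrable (fun x : Vec d => G i j * (x i * x j)) (multivariateGaussian 0 Q) := fun i j =>
    ((hm i).integrable_mul (hm j)).const_mul _
  simp_rw [h2]
  rw [integral_finsetSum _ fun i _ => integrable_finsetSum _ fun j _ => hint i j]
  simp only [trace, diag_apply, mul_apply]
  rw [Finset.sum_comm]
  refine Finset.sum_congr rfl fun i _ => ?_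
  rw [integral_finsetSum _ fun j _ => hint i j]
  refine Finset.sum_congr rfl fun j _ => ?_
  rw [integral_const_mul, h3, mul_comm]
  have hQs := hQ.1.apply i j
  rw [star_trivial] at hQs
  rw [hQs]

theorem ofReal_integral_sq_norm {f : Ω → Vec d} (hf : MemLp f 2 μ) :
    secondMoment μ f = ENNReal.ofReal (∫ ω, ‖f ω‖ ^ 2 ∂μ) := by
  rw [ofReal_integral_eq_lintegral_ofReal (integrable_sq_norm hf)
    (.of_forall fun _ => by positivity)]
  refine lintegral_congr fun ω => ?_
  rw [ENNReal.ofReal_pow (norm_nonneg _), ofReal_norm]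

theorem secondMoment_lt_top_iff {f : Ω → Vec d} (hf : AEStronglyMeasurable f μ) :
    secondMoment μ f < ⊤ ↔ MemLp f 2 μ := by
  constructor
  · intro h
    refine ⟨hf, ?_⟩
    rw [eLpNorm_lt_top_iff_lintegral_rpow_enorm_lt_top (by norm_num) (by norm_num)]
    simpa [secondMoment] using h
  · intro h
    rw [ofReal_integral_sq_norm h]
    exact ENNReal.ofReal_lt_top

end Moments

theorem inner_toEuclideanLin_right {ι κ : Type*} [Fintype ι] [Fintype κ] [DecidableEq ι]
    [DecidableEq κ] (G : Matrix ι κ ℝ) (x : EuclideanSpace ℝ ι) (y : EuclideanSpace ℝ κ) :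
    inner ℝ x (G.toEuclideanLin y) = inner ℝ (Gᵀ.toEuclideanLin x) y := by
  simp only [toLpLin_apply, EuclideanSpace.inner_eq_star_dotProduct, star_trivial]
  rw [mulVec_dotProduct, dotProduct_comm, mulVec_dotProduct, dotProduct_comm]

theorem quadForm_vecMulVec {d : ℕ} (a x : Vec d) :
    quadForm (vecMulVec a.ofLp a.ofLp) x = inner ℝ a x ^ 2 := by
  have h4 : (vecMulVec a.ofLp a.ofLp) *ᵥ x.ofLp = (x.ofLp ⬝ᵥ a.ofLp) • a.ofLp := by
    ext i
    simp only [mulVec, dotProduct, vecMulVec_apply, Pi.smul_apply, smul_eq_mul, Finset.sum_mul]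
    exact Finset.sum_congr rfl fun j _ => by ring
  simp only [quadForm, h4, dotProduct_smul, EuclideanSpace.inner_eq_star_dotProduct, star_trivial,
    smul_eq_mul]
  ring

/-! ### Invariance of the prediction error. -/

section Predictor

variable {Ω : Type} [MeasurableSpace Ω] {μ : Measure Ω} [IsProbabilityMeasure μ] {k m : ℕ}

/-- The added term is measurable for the conditioning σ-algebra, so it is its own predictor and
cancels. -/
theorem predError_add_ae {S : ℕ → Ω → Vec k} {Y : ℕ → Ω → Vec m} {t : ℕ}
    (hY : Measurable (past Y t)) (hYi : Integrable (past Y t) μ) (hS : Integrable (S t) μ)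
    (ℓ : ∀ t, (Fin t → Vec m) →ₗ[ℝ] Vec k) :
    predError μ (fun t ω => S t ω + ℓ t (past Y t ω)) Y t =ᵐ[μ] predError μ S Y t := by
  set L := LinearMap.toContinuousLinearMap (ℓ t)
  have hLi : Integrable (fun ω => L (past Y t ω)) μ := L.integrable_comp hYi
  have hadd := condExp_add hS hLi (MeasurableSpace.comap (past Y t) inferInstance)
  have hself : μ[fun ω => L (past Y t ω) | MeasurableSpace.comap (past Y t) inferInstance] =
      fun ω => L (past Y t ω) :=
    condExp_of_stronglyMeasurable hY.comap_le
      (L.continuous.measurable.comp (comap_measurable (past Y t))).stronglyMeasurable hLi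
  rw [hself] at hadd
  filter_upwards [hadd] with ω h
  have h' : predictor μ (fun t ω => S t ω + ℓ t (past Y t ω)) Y t ω =
      predictor μ S Y t ω + L (past Y t ω) := h
  simp only [predError, h']
  simp [L]

theorem errorCov_congr {S S' : ℕ → Ω → Vec k} {Y : ℕ → Ω → Vec m} {t : ℕ}
    (h : predError μ S Y t =ᵐ[μ] predError μ S' Y t) : errorCov μ S Y t = errorCov μ S' Y t := by
  ext i j
  have hi : ∀ i : Fin k, (fun ω => predError μ S Y t ω i) =ᵐ[μ] fun ω => predError μ S' Y t ω i :=
    fun i => by filter_upwards [h] with ω h; rw [h]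
  simp only [errorCov, of_apply, covariance]
  rw [integral_congr_ae (hi i), integral_congr_ae (hi j)]
  refine integral_congr_ae ?_
  filter_upwards [hi i, hi j] with ω h1 h2
  rw [h1, h2]

end Predictor

/-! ### Prediction errors, shifted systems and error covariances. -/

namespace CodedSystem

variable {Ω : Type} [MeasurableSpace Ω] {μ : Measure Ω} [IsProbabilityMeasure μ] {k m n : ℕ}
  {A Q : Matrix (Fin k) (Fin k) ℝ} {H : Matrix (Fin m) (Fin n) ℝ} {R : Matrix (Fin m) (Fin m) ℝ}
  {V : ℕ → Ω → Vec k} {sys : CodedSystem μ A Q H R V}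

theorem HasLinearInput.memLp_S (hV : sys.HasLinearInput) (t : ℕ) : MemLp (sys.S t) 2 μ :=
  ((hV.isLinearOf t).1.hasGaussianLaw (sys.hasGaussianLaw_driver t)).memLp_two

theorem HasLinearInput.memLp_past (hV : sys.HasLinearInput) (t : ℕ) :
    MemLp (past sys.Y t) 2 μ :=
  ((hV.isLinearOf t).2.hasGaussianLaw (sys.hasGaussianLaw_driver t)).memLp_two

theorem HasLinearInput.isLinearOf_predError (hV : sys.HasLinearInput) (t : ℕ) :
    IsLinearOf μ (sys.driver t) (predError μ sys.S sys.Y t) :=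
  CodedSystem.isLinearOf_predError (hV.isLinearOf t).1 (hV.isLinearOf t).2

theorem HasLinearInput.memLp_predError (hV : sys.HasLinearInput) (t : ℕ) :
    MemLp (predError μ sys.S sys.Y t) 2 μ :=
  ((hV.isLinearOf_predError t).hasGaussianLaw (sys.hasGaussianLaw_driver t)).memLp_two

theorem HasLinearInput.integral_predError (hV : sys.HasLinearInput) (t : ℕ) :
    ∫ ω, predError μ sys.S sys.Y t ω ∂μ = 0 :=
  (hV.isLinearOf_predError t).integral_eq_zero (sys.hasGaussianLaw_driver t)
    (sys.integral_driver t)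

/-- Linear regression on the past outputs: the predictor is linear in them and the prediction error
is independent of them. -/
theorem HasLinearInput.exists_predictor_eq (hV : sys.HasLinearInput) (t : ℕ) :
    ∃ π : (Fin t → Vec m) →L[ℝ] Vec k,
      predictor μ sys.S sys.Y t =ᵐ[μ] (fun ω => π (past sys.Y t ω)) ∧
      IndepFun (predError μ sys.S sys.Y t) (past sys.Y t) μ := by
  obtain ⟨π, h1, h2⟩ := CodedSystem.exists_predictor_eq (hV.isLinearOf t).1 (hV.isLinearOf t).2
  refine ⟨π, h1, h2.congr ?_ EventuallyEq.rfl⟩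
  filter_upwards [h1] with ω h
  simp [predError, h]

/-- Adding a linear function of the past channel outputs to the state changes neither the
prediction error nor the channel signals. -/
def shift (hV : sys.HasLinearInput) (ℓ : ∀ t, (Fin t → Vec m) →ₗ[ℝ] Vec k)
    {V' : ℕ → Ω → Vec k}
    (hV' : ∀ t ω, V' t ω = V t ω + ℓ (t + 1) (past sys.Y (t + 1) ω) -
      A.toEuclideanLin (ℓ t (past sys.Y t ω))) : CodedSystem μ A Q H R V' :=
  have hpred : ∀ t, predError μ (fun t ω => sys.S t ω + ℓ t (past sys.Y t ω)) sys.Y t =ᵐ[μ]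
      predError μ sys.S sys.Y t := fun t =>
    predError_add_ae (sys.measurable_past t) ((hV.memLp_past t).integrable (by norm_num))
      ((hV.memLp_S t).integrable (by norm_num)) ℓ
  -- The history at time 0 is empty, so the initial state is untouched.
  have h0 : (fun ω => sys.S 0 ω + ℓ 0 (past sys.Y 0 ω)) = sys.S 0 := by
    funext ω
    rw [Subsingleton.elim (past sys.Y 0 ω) 0, map_zero, add_zero]
  { S := fun t ω => sys.S t ω + ℓ t (past sys.Y t ω)
    X := sys.X
    Y := sys.Y
    W := sys.W
    Z := sys.Z
    M := sys.M
    Γ := sys.Γ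
    Θ := sys.Θ
    posSemidef_Θ := sys.posSemidef_Θ
    measurable_S := fun t => (sys.measurable_S t).add
      ((LinearMap.toContinuousLinearMap (ℓ t)).continuous.measurable.comp (sys.measurable_past t))
    measurable_X := sys.measurable_X
    measurable_Y := sys.measurable_Y
    measurable_W := sys.measurable_W
    measurable_Z := sys.measurable_Z
    measurable_M := sys.measurable_M
    law_init := by rw [h0]; exact sys.law_init
    law_noise := sys.law_noise
    indep_noise := sys.indep_noise
    indep_init := by rw [h0]; exact sys.indep_init
    state_eq := fun t ω => by rw [sys.state_eq, hV', map_add]; abel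
    channel_eq := sys.channel_eq
    -- The encoder sees the state only through its prediction error and the covariance of that
    -- error.
    encoder_eq := fun t => by
      rw [errorCov_congr (hpred t)]
      filter_upwards [sys.encoder_eq t, hpred t] with ω h1 h2
      rw [h1, h2] }

theorem HasLinearInput.errorCov_isHermitian (_hV : sys.HasLinearInput) (t : ℕ) :
    (errorCov μ sys.S sys.Y t).IsHermitian := by
  ext i j
  simp only [conjTranspose_apply, errorCov, of_apply, star_trivial]
  exact covariance_comm _ _

theorem HasLinearInput.integral_inner_mul_inner_predError (hV : sys.HasLinearInput) (t : ℕ)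
    (u b : Vec k) :
    ∫ ω, inner ℝ u (predError μ sys.S sys.Y t ω) * inner ℝ b (predError μ sys.S sys.Y t ω) ∂μ =
      u.ofLp ⬝ᵥ errorCov μ sys.S sys.Y t *ᵥ b.ofLp := by
  set e := predError μ sys.S sys.Y t with he
  have hm : ∀ i : Fin k, MemLp (fun ω => e ω i) 2 μ := fun i =>
    (EuclideanSpace.proj i : Vec k →L[ℝ] ℝ).comp_memLp' (hV.memLp_predError t)
  have hz : ∀ i : Fin k, ∫ ω, e ω i ∂μ = 0 := fun i => by
    have := (EuclideanSpace.proj i : Vec k →L[ℝ] ℝ).integral_comp_comm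
      ((hV.memLp_predError t).integrable (by norm_num))
    rw [hV.integral_predError t, map_zero] at this
    exact this
  have hP : ∀ i j : Fin k, ∫ ω, e ω i * e ω j ∂μ = errorCov μ sys.S sys.Y t i j := fun i j => by
    simp only [errorCov, of_apply, ← he]
    rw [covariance_eq_sub (hm i) (hm j), hz, zero_mul, sub_zero]
    rfl
  have hint : ∀ i j : Fin k, Integrable (fun ω => u i * b j * (e ω i * e ω j)) μ := fun i j =>
    ((hm i).integrable_mul (hm j)).const_mul _
  have h2 : ∀ ω, inner ℝ u (e ω) * inner ℝ b (e ω) =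
      ∑ i, ∑ j, u i * b j * (e ω i * e ω j) := fun ω => by
    simp only [PiLp.inner_apply, Finset.sum_mul_sum, RCLike.inner_apply, conj_trivial]
    exact Finset.sum_congr rfl fun i _ => Finset.sum_congr rfl fun j _ => by ring
  simp_rw [h2]
  rw [integral_finsetSum _ fun i _ => integrable_finsetSum _ fun j _ => hint i j]
  simp only [dotProduct, mulVec, Finset.mul_sum]
  refine Finset.sum_congr rfl fun i _ => ?_
  rw [integral_finsetSum _ fun j _ => hint i j]
  refine Finset.sum_congr rfl fun j _ => ?_
  rw [integral_const_mul, hP]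
  ring

/-- The encoder reveals only a bounded amount of information about the prediction error. -/
theorem HasLinearInput.dotProduct_errorCov_mulVec_le (hV : sys.HasLinearInput) (t : ℕ)
    (u : Vec k) (a : Vec m) :
    u.ofLp ⬝ᵥ errorCov μ sys.S sys.Y t *ᵥ
      ((H * (sys.Γ * (errorCov μ sys.S sys.Y t)⁻¹))ᵀ.toEuclideanLin a).ofLp ≤
      ‖LinearMap.toContinuousLinearMap (H * sys.Γ).toEuclideanLin‖ * ‖u‖ * ‖a‖ := by
  set P := errorCov μ sys.S sys.Y t with hP
  have hPt : Pᵀ = P :=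
    (conjTranspose_eq_transpose_of_trivial P).symm.trans (hV.errorCov_isHermitian t)
  -- P meets the P⁻¹ of the encoder; after cancellation only HΓ remains, which does not depend on t.
  have h1 : P *ᵥ ((H * (sys.Γ * P⁻¹))ᵀ.toEuclideanLin a).ofLp =
      (P * P⁻¹) *ᵥ ((H * sys.Γ)ᵀ *ᵥ a.ofLp) := by
    simp only [toLpLin_apply, mulVec_mulVec, transpose_mul, transpose_nonsing_inv, hPt,
      Matrix.mul_assoc]
  rw [h1]
  by_cases hu : IsUnit P.det
  · rw [mul_nonsing_inv _ hu, one_mulVec, ← mulVec_dotProduct]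
    have h2 : ((H * sys.Γ) *ᵥ u.ofLp) ⬝ᵥ a.ofLp =
        inner ℝ a (LinearMap.toContinuousLinearMap (H * sys.Γ).toEuclideanLin u) := by
      simp [EuclideanSpace.inner_eq_star_dotProduct, toLpLin_apply]
    rw [h2]
    calc _ ≤ ‖a‖ * ‖LinearMap.toContinuousLinearMap (H * sys.Γ).toEuclideanLin u‖ :=
          real_inner_le_norm _ _
      _ ≤ ‖a‖ * (‖LinearMap.toContinuousLinearMap (H * sys.Γ).toEuclideanLin‖ * ‖u‖) := by
        gcongr
        exact ContinuousLinearMap.le_opNorm _ _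
      _ = _ := by ring
  -- A singular P has inverse 0 by convention: the encoder then sends only its own noise, and the
  -- left side is 0.
  · rw [nonsing_inv_apply_not_isUnit _ hu]
    simp only [Matrix.mul_zero, zero_mulVec, dotProduct_zero]
    positivity

end CodedSystem

/-! ### One-step lower bound on the error variances. -/

namespace CodedSystem

variable {Ω : Type} [MeasurableSpace Ω] {μ : Measure Ω} [IsProbabilityMeasure μ] {k m n : ℕ}
  {A Q : Matrix (Fin k) (Fin k) ℝ} {H : Matrix (Fin m) (Fin n) ℝ} {R : Matrix (Fin m) (Fin m) ℝ}
  {V : ℕ → Ω → Vec k} {sys : CodedSystem μ A Q H R V}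

/-- A linear combination of the noises is at least as large as its channel noise part. -/
theorem le_integral_sq_noise (hR : R.PosDef) {r : ℝ} (hr : ∀ x : Vec m, r * ‖x‖ ^ 2 ≤ quadForm R x)
    (t : ℕ) (w : Vec k) (a : Vec m) (b : Vec n) :
    r * ‖a‖ ^ 2 ≤ ∫ ω, (inner ℝ w (sys.W t ω) -
      (inner ℝ b (sys.M t ω) + inner ℝ a (sys.Z t ω))) ^ 2 ∂μ := by
  have hW := (sys.hasLaw_W t).hasGaussianLaw.memLp_two
  have hZ := (sys.hasLaw_Z t).hasGaussianLaw.memLp_two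
  have hM := (sys.hasLaw_M t).hasGaussianLaw.memLp_two
  have hZ0 := integral_eq_zero_of_hasLaw (sys.hasLaw_Z t)
  have hM0 := integral_eq_zero_of_hasLaw (sys.hasLaw_M t)
  have hw : MemLp (fun ω => inner ℝ w (sys.W t ω)) 2 μ := (innerSL ℝ w).comp_memLp' hW
  have ha : MemLp (fun ω => inner ℝ a (sys.Z t ω)) 2 μ := (innerSL ℝ a).comp_memLp' hZ
  have hb : MemLp (fun ω => inner ℝ b (sys.M t ω)) 2 μ := (innerSL ℝ b).comp_memLp' hM
  have ha0 : ∫ ω, inner ℝ a (sys.Z t ω) ∂μ = 0 := by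
    have := (innerSL ℝ a).integral_comp_comm (hZ.integrable (by norm_num))
    rw [hZ0, map_zero] at this
    exact this
  have hb0 : ∫ ω, inner ℝ b (sys.M t ω) ∂μ = 0 := by
    have := (innerSL ℝ b).integral_comp_comm (hM.integrable (by norm_num))
    rw [hM0, map_zero] at this
    exact this
  have hba : MemLp (fun ω => inner ℝ b (sys.M t ω) + inner ℝ a (sys.Z t ω)) 2 μ := hb.add ha
  have h1 := integral_sq_add_of_indepFun hw hba.neg
    ((sys.indepFun_W_Z_M t).comp (φ := fun x => inner ℝ w x)
      (ψ := -fun x : Vec m × Vec n => inner ℝ b x.2 + inner ℝ a x.1)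
      (by fun_prop) (by fun_prop))
    (by
      simp only [Pi.neg_apply]
      rw [integral_neg, integral_add (hb.integrable (by norm_num)) (ha.integrable (by norm_num)),
        ha0, hb0]
      simp)
  have h2 := integral_sq_add_of_indepFun hb ha
    ((sys.indepFun_Z_M t).symm.comp (φ := fun x => inner ℝ b x) (ψ := fun x => inner ℝ a x)
      (by fun_prop) (by fun_prop)) ha0
  simp only [Pi.neg_apply, neg_sq, ← sub_eq_add_neg] at h1
  rw [h1, h2]
  have h3 : ∫ ω, inner ℝ a (sys.Z t ω) ^ 2 ∂μ = quadForm R a := by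
    simp_rw [← quadForm_vecMulVec]
    rw [integral_quadForm_of_hasLaw hR.posSemidef (sys.hasLaw_Z t), trace_mul_comm,
      vecMulVec_mul, trace_vecMulVec, quadForm, dotProduct_mulVec, dotProduct_comm]
  rw [h3]
  have h4 : 0 ≤ ∫ ω, inner ℝ w (sys.W t ω) ^ 2 ∂μ := integral_nonneg fun _ => sq_nonneg _
  have h5 : 0 ≤ ∫ ω, inner ℝ b (sys.M t ω) ^ 2 ∂μ := integral_nonneg fun _ => sq_nonneg _
  linarith [hr a]

/-- Separates the next error into a function of the past outputs, a function of the current error,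
and fresh noise. Here a records how the next predictor weighs the newest output; its value is
irrelevant later, as the variance bound holds for every a. -/
theorem HasLinearInput.predError_succ_ae (hV : sys.HasLinearInput) (t : ℕ) (w : Vec k) :
    ∃ (a : Vec m) (γ : StrongDual ℝ (Fin t → Vec m)), ∀ᵐ ω ∂μ,
      inner ℝ w (predError μ sys.S sys.Y (t + 1) ω) =
      (γ (past sys.Y t ω) + inner ℝ (Aᵀ.toEuclideanLin w -
        (H * (sys.Γ * (errorCov μ sys.S sys.Y t)⁻¹))ᵀ.toEuclideanLin a)
          (predError μ sys.S sys.Y t ω)) +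
      (inner ℝ w (sys.W t ω) -
        (inner ℝ (Hᵀ.toEuclideanLin a) (sys.M t ω) + inner ℝ a (sys.Z t ω))) := by
  obtain ⟨π, hπ, -⟩ := hV.exists_predictor_eq t
  obtain ⟨π', hπ', -⟩ := hV.exists_predictor_eq (t + 1)
  obtain ⟨v, hv⟩ := hV t
  -- The next predictor splits into its action T on the newest output and its action on the earlier
  -- ones, reached through `ext`.
  let T : Vec m →L[ℝ] Vec k := π' ∘L ContinuousLinearMap.single ℝ (fun _ => Vec m) (Fin.last t)
  let ext : (Fin t → Vec m) →L[ℝ] (Fin (t + 1) → Vec m) :=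
    ContinuousLinearMap.pi fun i =>
      Fin.lastCases (motive := fun _ => (Fin t → Vec m) →L[ℝ] Vec m) 0
        (fun j => ContinuousLinearMap.proj j) i
  let γ : StrongDual ℝ (Fin t → Vec m) :=
    innerSL ℝ w ∘L (LinearMap.toContinuousLinearMap v - π' ∘L ext) +
      innerSL ℝ (Aᵀ.toEuclideanLin w) ∘L π
  refine ⟨ContinuousLinearMap.adjoint T w, γ, ?_⟩
  set a := ContinuousLinearMap.adjoint T w with ha
  have hext : ∀ ω, past sys.Y (t + 1) ω =
      ext (past sys.Y t ω) + ContinuousLinearMap.single ℝ (fun _ => Vec m) (Fin.last t)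
        (sys.Y t ω) := fun ω => by
    funext i
    refine Fin.lastCases ?_ (fun j => ?_) i
    · simp [ext, past]
    · simp [ext, past]
  filter_upwards [hπ, hπ', sys.encoder_eq t] with ω h1 h2 h3
  have he : predError μ sys.S sys.Y t ω = sys.S t ω - π (past sys.Y t ω) := by
    simp [predError, h1]
  have he' : predError μ sys.S sys.Y (t + 1) ω =
      sys.S (t + 1) ω - π' (past sys.Y (t + 1) ω) := by
    simp [predError, h2]
  have hYa : inner ℝ a (sys.Y t ω) =
      inner ℝ ((H * (sys.Γ * (errorCov μ sys.S sys.Y t)⁻¹))ᵀ.toEuclideanLin a)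
        (predError μ sys.S sys.Y t ω) + inner ℝ (Hᵀ.toEuclideanLin a) (sys.M t ω) +
        inner ℝ a (sys.Z t ω) := by
    rw [sys.channel_eq, h3, map_add, inner_add_right, inner_add_right,
      ← inner_toEuclideanLin_right, ← inner_toEuclideanLin_right]
    congr 3
    simp only [toLpLin_apply, mulVec_mulVec]
  have hT : inner ℝ w (π' (ContinuousLinearMap.single ℝ (fun _ => Vec m) (Fin.last t)
      (sys.Y t ω))) = inner ℝ a (sys.Y t ω) := by
    rw [ha, ContinuousLinearMap.adjoint_inner_left]
    rfl
  have hγ : γ (past sys.Y t ω) = inner ℝ w (v (past sys.Y t ω)) -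
      inner ℝ w (π' (ext (past sys.Y t ω))) +
      inner ℝ (Aᵀ.toEuclideanLin w) (π (past sys.Y t ω)) := by
    simp [γ]
  have hS : sys.S t ω = predError μ sys.S sys.Y t ω + π (past sys.Y t ω) := by
    rw [he]; abel
  rw [he', sys.state_eq, hv, hext, map_add, hγ, inner_sub_right, inner_add_right, inner_add_right,
    inner_add_right w (π' _), hT, hYa, inner_toEuclideanLin_right, hS, inner_add_right,
    inner_sub_left]
  ring

/-- The prediction error variances can only shrink by a bounded amount relative to the
dynamics. -/
theorem HasLinearInput.le_integral_sq_predError_succ (hV : sys.HasLinearInput) (hR : R.PosDef)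
    {r : ℝ} (hr0 : 0 < r) (hr : ∀ x : Vec m, r * ‖x‖ ^ 2 ≤ quadForm R x) (t : ℕ) (w : Vec k) :
    ∫ ω, inner ℝ (Aᵀ.toEuclideanLin w) (predError μ sys.S sys.Y t ω) ^ 2 ∂μ -
      ‖LinearMap.toContinuousLinearMap (H * sys.Γ).toEuclideanLin‖ ^ 2 / r *
        ‖Aᵀ.toEuclideanLin w‖ ^ 2 ≤
    ∫ ω, inner ℝ w (predError μ sys.S sys.Y (t + 1) ω) ^ 2 ∂μ := by
  obtain ⟨a, γ, hae⟩ := hV.predError_succ_ae t w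
  set u := Aᵀ.toEuclideanLin w with hu
  set b := (H * (sys.Γ * (errorCov μ sys.S sys.Y t)⁻¹))ᵀ.toEuclideanLin a with hb
  set e := predError μ sys.S sys.Y t with he
  have heL : MemLp e 2 μ := hV.memLp_predError t
  have hinn : ∀ x : Vec k, MemLp (fun ω => inner ℝ x (e ω)) 2 μ := fun x =>
    (innerSL ℝ x).comp_memLp' heL
  have hinn0 : ∀ x : Vec k, ∫ ω, inner ℝ x (e ω) ∂μ = 0 := fun x => by
    have := (innerSL ℝ x).integral_comp_comm (heL.integrable (by norm_num))
    rw [hV.integral_predError t, map_zero] at this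
    exact this
  have hγL : MemLp (fun ω => γ (past sys.Y t ω)) 2 μ := γ.comp_memLp' (hV.memLp_past t)
  obtain ⟨-, -, hind⟩ := hV.exists_predictor_eq t
  -- The error is independent of the past, so the past contributes a separate nonnegative square,
  -- dropped below.
  have hE := integral_sq_add_of_indepFun hγL (hinn (u - b))
    (hind.symm.comp (φ := γ) (ψ := fun x => inner ℝ (u - b) x) γ.continuous.measurable
      (by fun_prop)) (hinn0 _)
  set P₁ : Ω → ℝ := fun ω => γ (past sys.Y t ω) + inner ℝ (u - b) (e ω) with hP₁
  set P₂ : Ω → ℝ := fun ω => inner ℝ w (sys.W t ω) -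
        (inner ℝ (Hᵀ.toEuclideanLin a) (sys.M t ω) + inner ℝ a (sys.Z t ω)) with hP₂
  have hW := (sys.hasLaw_W t).hasGaussianLaw.memLp_two
  have hZ := (sys.hasLaw_Z t).hasGaussianLaw.memLp_two
  have hM := (sys.hasLaw_M t).hasGaussianLaw.memLp_two
  let N : StrongDual ℝ (Vec k × Vec m × Vec n) :=
    innerSL ℝ w ∘L ContinuousLinearMap.fst ℝ _ _ -
      (innerSL ℝ (Hᵀ.toEuclideanLin a) ∘L ContinuousLinearMap.snd ℝ _ _ ∘L
        ContinuousLinearMap.snd ℝ _ _ +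
      innerSL ℝ a ∘L ContinuousLinearMap.fst ℝ _ _ ∘L ContinuousLinearMap.snd ℝ _ _)
  have hN : P₂ = fun ω => N (sys.noise t ω) := rfl
  have hNL : MemLp (sys.noise t) 2 μ := (sys.hasGaussianLaw_noise t).memLp_two
  have hP₂L : MemLp P₂ 2 μ := by rw [hN]; exact N.comp_memLp' hNL
  have hP₂0 : ∫ ω, P₂ ω ∂μ = 0 := by
    rw [hN, N.integral_comp_comm (hNL.integrable (by norm_num)), sys.integral_noise, map_zero]
  have hP₁lin : IsLinearOf μ (sys.driver t) P₁ :=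
    ((hV.isLinearOf t).2.comp γ).add ((hV.isLinearOf_predError t).comp (innerSL ℝ (u - b)))
  have hP : IndepFun P₁ P₂ μ :=
    (hP₁lin.indepFun (sys.indepFun_driver_noise t)).comp measurable_id N.continuous.measurable
  have hsum := integral_sq_add_of_indepFun (hγL.add (hinn (u - b))) hP₂L hP hP₂0
  have hlhs : ∫ ω, inner ℝ w (predError μ sys.S sys.Y (t + 1) ω) ^ 2 ∂μ =
      ∫ ω, (P₁ ω + P₂ ω) ^ 2 ∂μ := by
    refine integral_congr_ae ?_
    filter_upwards [hae] with ω h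
    rw [h]
  have hnoise := sys.le_integral_sq_noise hR hr t w a (Hᵀ.toEuclideanLin a)
  have hexp : ∫ ω, inner ℝ (u - b) (e ω) ^ 2 ∂μ = ∫ ω, inner ℝ u (e ω) ^ 2 ∂μ -
      2 * (∫ ω, inner ℝ u (e ω) * inner ℝ b (e ω) ∂μ) + ∫ ω, inner ℝ b (e ω) ^ 2 ∂μ := by
    have i1 := (hinn u).integrable_sq
    have i2 : Integrable (fun ω => 2 * (inner ℝ u (e ω) * inner ℝ b (e ω))) μ :=
      ((hinn u).integrable_mul (hinn b)).const_mul 2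
    have i3 := (hinn b).integrable_sq
    have h : ∀ ω, inner ℝ (u - b) (e ω) ^ 2 = inner ℝ u (e ω) ^ 2 -
        2 * (inner ℝ u (e ω) * inner ℝ b (e ω)) + inner ℝ b (e ω) ^ 2 := fun ω => by
      rw [inner_sub_left]; ring
    simp_rw [h]
    have i12 : Integrable (fun ω => inner ℝ u (e ω) ^ 2 -
        2 * (inner ℝ u (e ω) * inner ℝ b (e ω))) μ := i1.sub i2
    rw [integral_add i12 i3, integral_sub i1 i2, integral_const_mul]
  have hcross := hV.dotProduct_errorCov_mulVec_le t u a
  rw [← hb, ← hV.integral_inner_mul_inner_predError t u b, ← he] at hcross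
  have hγ0 : 0 ≤ ∫ ω, γ (past sys.Y t ω) ^ 2 ∂μ := integral_nonneg fun _ => sq_nonneg _
  have hb0 : 0 ≤ ∫ ω, inner ℝ b (e ω) ^ 2 ∂μ := integral_nonneg fun _ => sq_nonneg _
  rw [hlhs]
  change _ ≤ ∫ ω, (P₁ ω + P₂ ω) ^ 2 ∂μ
  have hsum' : ∫ ω, (P₁ ω + P₂ ω) ^ 2 ∂μ = ∫ ω, P₁ ω ^ 2 ∂μ + ∫ ω, P₂ ω ^ 2 ∂μ := hsum
  rw [hsum', hE, hexp]
  set g := ‖LinearMap.toContinuousLinearMap (H * sys.Γ).toEuclideanLin‖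
  -- Relying on Y_t with weight a lowers the variance by at most this cross term but imports channel
  -- noise of at least r‖a‖²; the net gain is at most g²/r ‖u‖², whatever a is.
  have hsq : 2 * (g * ‖u‖ * ‖a‖) ≤ g ^ 2 / r * ‖u‖ ^ 2 + r * ‖a‖ ^ 2 := by
    have h1 : 0 ≤ (g * ‖u‖ - r * ‖a‖) ^ 2 / r := by positivity
    have h2 : (g * ‖u‖ - r * ‖a‖) ^ 2 / r =
        g ^ 2 / r * ‖u‖ ^ 2 + r * ‖a‖ ^ 2 - 2 * (g * ‖u‖ * ‖a‖) := by
      field_simp; ring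
    linarith
  linarith

end CodedSystem

/-! ### Long-run averages and further moment bounds. -/

section Averages

theorem sum_Icc_one_eq_sum_range {α : Type*} [AddCommMonoid α] (f : ℕ → α) (T : ℕ) :
    ∑ t ∈ Finset.Icc 1 T, f t = ∑ i ∈ Finset.range T, f (1 + i) := by
  induction T with
  | zero => simp
  | succ T ih => rw [Finset.sum_Icc_succ_top (by omega), Finset.sum_range_succ, ih, add_comm T 1]

theorem longRunAverage_le_of_forall_le {a : ℕ → ℝ≥0∞} {c : ℝ≥0∞} (h : ∀ t, a t ≤ c) :
    longRunAverage a ≤ c := by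
  refine limsup_le_of_le (by isBoundedDefault) (.of_forall fun T => ?_)
  refine ENNReal.div_le_of_le_mul ?_
  calc _ ≤ ∑ _t ∈ Finset.Icc 1 T, c := Finset.sum_le_sum fun t _ => h t
    _ = _ := by simp [mul_comm]

/-- One term is at most the whole partial sum, hence grows at most linearly. The + 1 gives the
strict inequality needed to pass from the limsup to an eventual bound. -/
theorem eventually_le_mul_of_longRunAverage_le {a : ℕ → ℝ≥0∞} {D : ℝ≥0}
    (h : longRunAverage a ≤ D) : ∀ᶠ T : ℕ in atTop, a T ≤ ENNReal.ofReal ((D + 1) * T) := by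
  have h1 : longRunAverage a < ((D + 1 : ℝ≥0) : ℝ≥0∞) :=
    h.trans_lt (by exact_mod_cast lt_add_one D)
  filter_upwards [eventually_lt_of_limsup_lt h1 (by isBoundedDefault), eventually_ge_atTop 1]
    with T hT hT1
  have h2 : ∑ t ∈ Finset.Icc 1 T, a t ≤ ((D + 1 : ℝ≥0) : ℝ≥0∞) * T :=
    (ENNReal.div_le_iff (by positivity) (ENNReal.natCast_ne_top T)).1 hT.le
  refine (Finset.single_le_sum (f := a) (fun _ _ => bot_le)
    (Finset.mem_Icc.2 ⟨hT1, le_rfl⟩)).trans (h2.trans (le_of_eq ?_))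
  rw [ENNReal.ofReal_mul (by positivity), ENNReal.ofReal_natCast]
  congr 1
  rw [← NNReal.coe_one, ← NNReal.coe_add, ENNReal.ofReal_coe_nnreal]

/-- The limsup bounds a tail; the finitely many earlier terms are finite and are added to the bound.
-/
theorem exists_forall_le_of_limsup_lt_top {a : ℕ → ℝ≥0∞} (h : limsup a atTop < ⊤)
    (ha : ∀ t, a t < ⊤) : ∃ D : ℝ≥0, ∀ t, a t ≤ D := by
  obtain ⟨c, hc1, hc2⟩ := exists_between h
  obtain ⟨N, hN⟩ := eventually_atTop.1 (eventually_lt_of_limsup_lt hc1 (by isBoundedDefault))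
  have hfin : c + ∑ t ∈ Finset.range N, a t ≠ ⊤ :=
    ENNReal.add_ne_top.2 ⟨hc2.ne, (ENNReal.sum_lt_top.2 fun t _ => ha t).ne⟩
  refine ⟨(c + ∑ t ∈ Finset.range N, a t).toNNReal, fun t => ?_⟩
  rw [ENNReal.coe_toNNReal hfin]
  rcases lt_or_ge t N with ht | ht
  · exact (Finset.single_le_sum (f := a) (fun _ _ => bot_le) (Finset.mem_range.2 ht)).trans
      le_add_self
  · exact (hN t ht).le.trans le_self_add

end Averages

section Moments

variable {Ω : Type} [MeasurableSpace Ω] {μ : Measure Ω} [IsProbabilityMeasure μ] {k : ℕ}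

theorem integral_sq_inner_le {f : Ω → Vec k} (hf : MemLp f 2 μ) (u : Vec k) :
    ∫ ω, inner ℝ u (f ω) ^ 2 ∂μ ≤ ‖u‖ ^ 2 * ∫ ω, ‖f ω‖ ^ 2 ∂μ := by
  rw [← integral_const_mul]
  refine integral_mono ((innerSL ℝ u).comp_memLp' hf).integrable_sq
    ((integrable_sq_norm hf).const_mul _) fun ω => ?_
  have h := abs_real_inner_le_norm u (f ω)
  have h2 := sq_le_sq' (neg_le_of_abs_le h) (le_of_abs_le h)
  simpa [mul_pow] using h2

theorem integral_sq_norm_le_of_forall {f : Ω → Vec k} (hf : MemLp f 2 μ) {c : ℝ}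
    (h : ∀ u : Vec k, ∫ ω, inner ℝ u (f ω) ^ 2 ∂μ ≤ c * ‖u‖ ^ 2) :
    ∫ ω, ‖f ω‖ ^ 2 ∂μ ≤ k * c := by
  have h1 : ∀ ω, ‖f ω‖ ^ 2 = ∑ i : Fin k, inner ℝ (EuclideanSpace.single i (1 : ℝ)) (f ω) ^ 2 :=
    fun ω => by
      rw [EuclideanSpace.real_norm_sq_eq]
      simp [EuclideanSpace.inner_single_left]
  have h2 : ∀ i : Fin k,
      Integrable (fun ω => inner ℝ (EuclideanSpace.single i (1 : ℝ)) (f ω) ^ 2) μ :=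
    fun i => ((innerSL ℝ _).comp_memLp' hf).integrable_sq
  simp_rw [h1]
  rw [integral_finsetSum _ fun i _ => h2 i]
  calc _ ≤ ∑ _i : Fin k, c := Finset.sum_le_sum fun i _ => by
        simpa using h (EuclideanSpace.single i 1)
    _ = _ := by simp

theorem integral_quadForm_le {G : Matrix (Fin k) (Fin k) ℝ} {c : ℝ}
    (hG : ∀ x : Vec k, quadForm G x ≤ c * ‖x‖ ^ 2) {f : Ω → Vec k} (hf : MemLp f 2 μ) :
    ∫ ω, quadForm G (f ω) ∂μ ≤ c * ∫ ω, ‖f ω‖ ^ 2 ∂μ := by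
  rw [← integral_const_mul]
  exact integral_mono (integrable_quadForm G hf) ((integrable_sq_norm hf).const_mul _)
    fun ω => hG _

theorem le_integral_quadForm {G : Matrix (Fin k) (Fin k) ℝ} {c : ℝ}
    (hG : ∀ x : Vec k, c * ‖x‖ ^ 2 ≤ quadForm G x) {f : Ω → Vec k} (hf : MemLp f 2 μ) :
    c * ∫ ω, ‖f ω‖ ^ 2 ∂μ ≤ ∫ ω, quadForm G (f ω) ∂μ := by
  rw [← integral_const_mul]
  exact integral_mono ((integrable_sq_norm hf).const_mul _) (integrable_quadForm G hf)
    fun ω => hG _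

theorem integral_sq_norm_sub_le {f g : Ω → Vec k} (hf : MemLp f 2 μ) (hg : MemLp g 2 μ) :
    ∫ ω, ‖f ω - g ω‖ ^ 2 ∂μ ≤ 2 * ∫ ω, ‖f ω‖ ^ 2 ∂μ + 2 * ∫ ω, ‖g ω‖ ^ 2 ∂μ := by
  rw [← integral_const_mul, ← integral_const_mul,
    ← integral_add ((integrable_sq_norm hf).const_mul _) ((integrable_sq_norm hg).const_mul _)]
  refine integral_mono (integrable_sq_norm (hf.sub hg))
    (((integrable_sq_norm hf).const_mul _).add ((integrable_sq_norm hg).const_mul _)) fun ω => ?_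
  have h := norm_sub_le (f ω) (g ω)
  have h0 := norm_nonneg (f ω - g ω)
  simp only
  nlinarith [sq_nonneg (‖f ω‖ - ‖g ω‖)]

theorem integral_sq_norm_map_le {l : ℕ} (L : Vec k →L[ℝ] Vec l) {f : Ω → Vec k}
    (hf : MemLp f 2 μ) :
    ∫ ω, ‖L (f ω)‖ ^ 2 ∂μ ≤ ‖L‖ ^ 2 * ∫ ω, ‖f ω‖ ^ 2 ∂μ := by
  rw [← integral_const_mul]
  refine integral_mono (integrable_sq_norm (L.comp_memLp' hf))
    ((integrable_sq_norm hf).const_mul _) fun ω => ?_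
  have := L.le_opNorm (f ω)
  calc ‖L (f ω)‖ ^ 2 ≤ (‖L‖ * ‖f ω‖) ^ 2 := by gcongr
    _ = _ := by ring

end Moments

/-! ### Uniformly bounded prediction errors and Bellman's inequality. -/

namespace CodedSystem

variable {Ω : Type} [MeasurableSpace Ω] {μ : Measure Ω} [IsProbabilityMeasure μ] {k l m n : ℕ}
  {A Q : Matrix (Fin k) (Fin k) ℝ} {H : Matrix (Fin m) (Fin n) ℝ} {R : Matrix (Fin m) (Fin m) ℝ}
  {V : ℕ → Ω → Vec k} {sys : CodedSystem μ A Q H R V}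

/-- The predictor minimizes the mean-squared error among all measurable functions of the past. -/
theorem HasLinearInput.secondMoment_predError_le (hV : sys.HasLinearInput) {t : ℕ}
    {g : (Fin t → Vec m) → Vec k} (hg : Measurable g) :
    secondMoment μ (predError μ sys.S sys.Y t) ≤
      secondMoment μ fun ω => sys.S t ω - g (past sys.Y t ω) := by
  rcases eq_or_ne (secondMoment μ fun ω => sys.S t ω - g (past sys.Y t ω)) ⊤ with h | h
  · rw [h]; exact le_top
  have hfm : Measurable fun ω => sys.S t ω - g (past sys.Y t ω) :=
    (sys.measurable_S t).sub (hg.comp (sys.measurable_past t))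
  have hf := (secondMoment_lt_top_iff hfm.aestronglyMeasurable).1 (lt_top_iff_ne_top.2 h)
  obtain ⟨π, hπ, hind⟩ := hV.exists_predictor_eq t
  set e := predError μ sys.S sys.Y t with he
  have heL : MemLp e 2 μ := hV.memLp_predError t
  have hae : (fun ω => sys.S t ω - g (past sys.Y t ω)) =ᵐ[μ]
      fun ω => (π (past sys.Y t ω) - g (past sys.Y t ω)) + e ω := by
    filter_upwards [hπ] with ω h
    simp [he, predError, h]
  have hh : MemLp (fun ω => π (past sys.Y t ω) - g (past sys.Y t ω)) 2 μ := by
    refine (hf.sub heL).ae_eq ?_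
    filter_upwards [hae] with ω h
    simp only [Pi.sub_apply, h, add_sub_cancel_right]
  -- Pythagoras: the prediction error is centred and independent of every function of the past
  -- outputs.
  have hsum := integral_sq_norm_add_of_indepFun hh heL
    (hind.symm.comp (φ := fun y => π y - g y) (ψ := id)
      (π.continuous.measurable.sub hg) measurable_id) (hV.integral_predError t)
  rw [ofReal_integral_sq_norm heL, ofReal_integral_sq_norm hf]
  refine ENNReal.ofReal_le_ofReal ?_
  have h1 : ∫ ω, ‖sys.S t ω - g (past sys.Y t ω)‖ ^ 2 ∂μ =
      ∫ ω, ‖π (past sys.Y t ω) - g (past sys.Y t ω) + e ω‖ ^ 2 ∂μ := by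
    refine integral_congr_ae ?_
    filter_upwards [hae] with ω h
    rw [h]
  rw [h1, hsum]
  have : 0 ≤ ∫ ω, ‖π (past sys.Y t ω) - g (past sys.Y t ω)‖ ^ 2 ∂μ :=
    integral_nonneg fun _ => by positivity
  linarith

/-- For an expanding system, a finite average distortion forces uniformly bounded prediction
errors. -/
theorem HasLinearInput.exists_bound_predError (hV : sys.HasLinearInput) (hR : R.PosDef)
    (hA : ∀ z ∈ spectrum ℂ (A.map (algebraMap ℝ ℂ)), 1 < ‖z‖)
    {g : (t : ℕ) → (Fin t → Vec m) → Vec k} (hg : ∀ t, Measurable (g t)) {D : ℝ≥0}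
    (hD : longRunAverage (fun t => secondMoment μ (fun ω => sys.S t ω - g t (past sys.Y t ω)))
      ≤ D) :
    ∃ c, 0 ≤ c ∧ ∀ t, ∫ ω, ‖predError μ sys.S sys.Y t ω‖ ^ 2 ∂μ ≤ c := by
  obtain ⟨c, ρ, hc, h0, h1, hT⟩ := exists_norm_inv_pow_le hA
  obtain ⟨r, hr0, hr⟩ := exists_pos_mul_sq_le_of_posDef hR
  have hdet := isUnit_of_one_lt_norm_spectrum hA
  set T := toEuclideanCLM (𝕜 := ℝ) (A⁻¹)ᵀ with hTdef
  have hAT : ∀ u, Aᵀ.toEuclideanLin (T u) = u := fun u => by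
    have h2 : T u = (A⁻¹)ᵀ.toEuclideanLin u := rfl
    rw [h2]
    simp only [toLpLin_apply, mulVec_mulVec, ← transpose_mul, nonsing_inv_mul _ hdet,
      transpose_one, one_mulVec]
  have hgrow : ∀ᶠ t : ℕ in atTop, ∀ u : Vec k,
      ∫ ω, inner ℝ u (predError μ sys.S sys.Y t ω) ^ 2 ∂μ ≤ (D + 1) * t * ‖u‖ ^ 2 := by
    filter_upwards [eventually_le_mul_of_longRunAverage_le hD] with t ht u
    have h2 := (hV.secondMoment_predError_le (hg t)).trans ht
    rw [ofReal_integral_sq_norm (hV.memLp_predError t),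
      ENNReal.ofReal_le_ofReal_iff (by positivity)] at h2
    calc _ ≤ ‖u‖ ^ 2 * ∫ ω, ‖predError μ sys.S sys.Y t ω‖ ^ 2 ∂μ :=
          integral_sq_inner_le (hV.memLp_predError t) u
      _ ≤ ‖u‖ ^ 2 * ((D + 1) * t) := by gcongr
      _ = _ := by ring
  set γ := ‖LinearMap.toContinuousLinearMap (H * sys.Γ).toEuclideanLin‖ ^ 2 / r
  have hγ : 0 ≤ γ := by positivity
  -- The one-step bound is used at w = Tu, for which Aᵀw = u.
  have hb := fun t => bounded_of_expanding h0 h1 hγ (by positivity) hT (fun t u => by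
    have := hV.le_integral_sq_predError_succ hR hr0 hr t (T u)
    rwa [hAT] at this) hgrow t
  have h2 : 0 ≤ γ * (c ^ 2 / (1 - ρ ^ 2)) :=
    mul_nonneg hγ (div_nonneg (sq_nonneg c) (by nlinarith))
  exact ⟨k * (γ * (c ^ 2 / (1 - ρ ^ 2))), by positivity, fun t =>
    integral_sq_norm_le_of_forall (hV.memLp_predError t) (hb t)⟩

/-- Bellman's inequality for one step of the controlled system. -/
theorem integral_riccatiIter_le {B : Matrix (Fin k) (Fin l) ℝ} {C : Matrix (Fin k) (Fin k) ℝ}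
    {E : Matrix (Fin l) (Fin l) ℝ} {U : ℕ → Ω → Vec l}
    {sys : CodedSystem μ A Q H R (fun t ω => B.toEuclideanLin (U t ω))}
    (hV : sys.HasLinearInput) (hQ : Q.PosDef) (hC : C.PosDef) (hE : E.PosDef)
    {t : ℕ} {G : (Fin t → Vec m) →ₗ[ℝ] Vec l} (hU : ∀ ω, U t ω = G (past sys.Y t ω)) (j : ℕ) :
    ∫ ω, quadForm (riccatiIter A B C E (j + 1)) (sys.S t ω) ∂μ +
      (Q * riccatiIter A B C E j).trace ≤
    ∫ ω, (quadForm C (sys.S t ω) + quadForm E (U t ω)) ∂μ +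
      ∫ ω, quadForm (riccatiIter A B C E j) (sys.S (t + 1) ω) ∂μ := by
  set F := riccatiIter A B C E j with hF
  have hFp : F.PosSemidef := riccatiIter_posSemidef hC hE j
  have hS := hV.memLp_S t
  have hUlin : IsLinearOf μ (sys.driver t) (U t) :=
    ((hV.isLinearOf t).2.comp (LinearMap.toContinuousLinearMap G)).congr (.of_forall hU)
  have hUL : MemLp (U t) 2 μ := (hUlin.hasGaussianLaw (sys.hasGaussianLaw_driver t)).memLp_two
  have hX : IsLinearOf μ (sys.driver t)
      fun ω => A.toEuclideanLin (sys.S t ω) + B.toEuclideanLin (U t ω) :=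
    ((hV.isLinearOf t).1.comp (LinearMap.toContinuousLinearMap A.toEuclideanLin)).add
      (hUlin.comp (LinearMap.toContinuousLinearMap B.toEuclideanLin))
  have hXL := (hX.hasGaussianLaw (sys.hasGaussianLaw_driver t)).memLp_two
  have hW := (sys.hasLaw_W t).hasGaussianLaw.memLp_two
  -- W_t is centred and independent of A S_t + B U_t, so it contributes exactly Tr(QF) to the
  -- cost-to-go.
  have h1 := integral_quadForm_add_of_indepFun F hXL hW
    ((hX.indepFun (sys.indepFun_driver_noise t)).comp measurable_id measurable_fst)
    (integral_eq_zero_of_hasLaw (sys.hasLaw_W t))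
  rw [integral_quadForm_of_hasLaw hQ.posSemidef (sys.hasLaw_W t)] at h1
  simp_rw [← sys.state_eq t] at h1
  rw [h1, ← add_assoc]
  gcongr
  have iC := integrable_quadForm C hS
  have iE := integrable_quadForm E hUL
  have iCE : Integrable (fun ω => quadForm C (sys.S t ω) + quadForm E (U t ω)) μ := iC.add iE
  rw [← integral_add iCE (integrable_quadForm F hXL)]
  refine integral_mono (integrable_quadForm _ hS) (iCE.add (integrable_quadForm F hXL))
    fun ω => ?_
  have h2 := riccatiStep_le (A := A) (B := B) (C := C) hE hFp (sys.S t ω).ofLp (U t ω).ofLp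
  rw [riccatiIter_succ, ← hF]
  simpa [quadForm, toLpLin_apply] using h2

/-- Bellman's inequality telescoped: with T steps to go the weight is the T-th iterate, and each
step moves the starting time s forward by one. The zeroth iterate is 0, so no terminal cost remains.
-/
theorem sum_trace_riccatiIter_le {B : Matrix (Fin k) (Fin l) ℝ} {C : Matrix (Fin k) (Fin k) ℝ}
    {E : Matrix (Fin l) (Fin l) ℝ} {U : ℕ → Ω → Vec l}
    {sys : CodedSystem μ A Q H R (fun t ω => B.toEuclideanLin (U t ω))}
    (hV : sys.HasLinearInput) (hQ : Q.PosDef) (hC : C.PosDef) (hE : E.PosDef)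
    {G : (t : ℕ) → (Fin t → Vec m) →ₗ[ℝ] Vec l} (hU : ∀ t ω, U t ω = G t (past sys.Y t ω))
    (T s : ℕ) :
    ∑ j ∈ Finset.range T, (Q * riccatiIter A B C E j).trace +
      ∫ ω, quadForm (riccatiIter A B C E T) (sys.S s ω) ∂μ ≤
    ∑ i ∈ Finset.range T,
      ∫ ω, (quadForm C (sys.S (s + i) ω) + quadForm E (U (s + i) ω)) ∂μ := by
  induction T generalizing s with
  | zero => simp [riccatiIter, quadForm]
  | succ T ih =>
    have h1 := integral_riccatiIter_le hV hQ hC hE (hU s) T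
    have h2 := ih (s + 1)
    rw [Finset.sum_range_succ, Finset.sum_range_succ', add_zero]
    simp_rw [add_assoc s 1, add_comm 1] at h2
    linarith

end CodedSystem

/-- The linear functions of the past outputs generated by a recursion in time, started at `0`. -/
noncomputable def recursiveFilter {k m : ℕ}
    (f : ∀ t, ((Fin t → Vec m) →ₗ[ℝ] Vec k) → ((Fin t → Vec m) →ₗ[ℝ] Vec k)) :
    ∀ t, (Fin t → Vec m) →ₗ[ℝ] Vec k
  | 0 => 0
  | t + 1 => f t (recursiveFilter f t) ∘ₗ LinearMap.funLeft ℝ (Vec m) Fin.castSucc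

theorem recursiveFilter_succ_past {Ω : Type} {k m : ℕ}
    (f : ∀ t, ((Fin t → Vec m) →ₗ[ℝ] Vec k) → ((Fin t → Vec m) →ₗ[ℝ] Vec k))
    (Y : ℕ → Ω → Vec m) (t : ℕ) (ω : Ω) :
    recursiveFilter f (t + 1) (past Y (t + 1) ω) = f t (recursiveFilter f t) (past Y t ω) :=
  rfl

/-! ### Finiteness of the LQR cost. -/

section StageCost

variable {Ω : Type} [MeasurableSpace Ω] {μ : Measure Ω} [IsProbabilityMeasure μ] {k l : ℕ}
  {C : Matrix (Fin k) (Fin k) ℝ} {E : Matrix (Fin l) (Fin l) ℝ}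

theorem lintegral_quadForm_add (hC : C.PosDef) (hE : E.PosDef) {S : Ω → Vec k} {U : Ω → Vec l}
    (hS : MemLp S 2 μ) (hU : MemLp U 2 μ) :
    ∫⁻ ω, ENNReal.ofReal (quadForm C (S ω) + quadForm E (U ω)) ∂μ =
      ENNReal.ofReal (∫ ω, (quadForm C (S ω) + quadForm E (U ω)) ∂μ) :=
  (ofReal_integral_eq_lintegral_ofReal
    ((integrable_quadForm C hS).add (integrable_quadForm E hU)) (.of_forall fun _ =>
      add_nonneg (quadForm_nonneg hC.posSemidef _) (quadForm_nonneg hE.posSemidef _))).symm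

/-- The terminal cost is nonnegative and may be discarded. -/
theorem eventually_sum_integral_le_of_lqrCost_lt_top (hC : C.PosDef) (hE : E.PosDef)
    {S : ℕ → Ω → Vec k} {U : ℕ → Ω → Vec l} (hS : ∀ t, MemLp (S t) 2 μ)
    (hU : ∀ t, MemLp (U t) 2 μ) (h : lqrCost μ C E S U < ⊤) :
    ∃ c : ℝ, ∀ᶠ T : ℕ in atTop,
      ∑ i ∈ Finset.range T, ∫ ω, (quadForm C (S (1 + i) ω) + quadForm E (U (1 + i) ω)) ∂μ
        ≤ c * T := by
  obtain ⟨c, hc1, hc2⟩ := exists_between h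
  refine ⟨c.toReal, ?_⟩
  filter_upwards [eventually_lt_of_limsup_lt hc1 (by isBoundedDefault), eventually_ge_atTop 1]
    with T hT hT1
  have hT0 : (T : ℝ≥0∞) ≠ 0 := by simp; omega
  have h1 := (le_self_add.trans ((ENNReal.div_le_iff hT0 (ENNReal.natCast_ne_top T)).1 hT.le))
  have hnn : ∀ t, 0 ≤ ∫ ω, (quadForm C (S t ω) + quadForm E (U t ω)) ∂μ := fun t =>
    integral_nonneg fun _ =>
      add_nonneg (quadForm_nonneg hC.posSemidef _) (quadForm_nonneg hE.posSemidef _)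
  rw [Finset.sum_congr rfl fun t _ => lintegral_quadForm_add hC hE (hS t) (hU t),
    ← ENNReal.ofReal_sum_of_nonneg fun t _ => hnn t, sum_Icc_one_eq_sum_range] at h1
  have h2 := (ENNReal.ofReal_le_iff_le_toReal
    (ENNReal.mul_ne_top hc2.ne (ENNReal.natCast_ne_top T))).1 h1
  simpa using h2

theorem lqrCost_lt_top_of_forall_le (hC : C.PosDef) (hE : E.PosDef)
    {S : ℕ → Ω → Vec k} {U : ℕ → Ω → Vec l} (hS : ∀ t, MemLp (S t) 2 μ)
    (hU : ∀ t, MemLp (U t) 2 μ) {a b : ℝ} (ha : ∀ t, ∫ ω, ‖S t ω‖ ^ 2 ∂μ ≤ a)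
    (hb : ∀ t, ∫ ω, ‖U t ω‖ ^ 2 ∂μ ≤ b) : lqrCost μ C E S U < ⊤ := by
  obtain ⟨c, hc, hCc⟩ := exists_quadForm_le C
  obtain ⟨d, hd, hEd⟩ := exists_quadForm_le E
  have h1 : ∀ t, ∫ ω, quadForm C (S t ω) ∂μ ≤ c * a := fun t =>
    (integral_quadForm_le hCc (hS t)).trans (by gcongr; exact ha t)
  have h2 : ∀ t, ∫ ω, quadForm E (U t ω) ∂μ ≤ d * b := fun t =>
    (integral_quadForm_le hEd (hU t)).trans (by gcongr; exact hb t)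
  have h3 : ∀ t, ∫⁻ ω, ENNReal.ofReal (quadForm C (S t ω) + quadForm E (U t ω)) ∂μ ≤
      ENNReal.ofReal (c * a + d * b) := fun t => by
    rw [lintegral_quadForm_add hC hE (hS t) (hU t),
      integral_add (integrable_quadForm C (hS t)) (integrable_quadForm E (hU t))]
    exact ENNReal.ofReal_le_ofReal (add_le_add (h1 t) (h2 t))
  have h4 : ∀ t, ∫⁻ ω, ENNReal.ofReal (quadForm C (S t ω)) ∂μ ≤ ENNReal.ofReal (c * a) :=
    fun t => by
      rw [← ofReal_integral_eq_lintegral_ofReal (integrable_quadForm C (hS t))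
        (.of_forall fun _ => quadForm_nonneg hC.posSemidef _)]
      exact ENNReal.ofReal_le_ofReal (h1 t)
  refine lt_of_le_of_lt (b := ENNReal.ofReal (c * a + d * b) + ENNReal.ofReal (c * a)) ?_
    (ENNReal.add_lt_top.2 ⟨ENNReal.ofReal_lt_top, ENNReal.ofReal_lt_top⟩)
  refine limsup_le_of_le (by isBoundedDefault) ?_
  -- For T ≥ 1 the single terminal term is at most T times its bound.
  filter_upwards [eventually_ge_atTop 1] with T hT
  refine ENNReal.div_le_of_le_mul ?_
  rw [add_mul]
  refine add_le_add ?_ ((h4 T).trans ?_)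
  · calc _ ≤ ∑ _t ∈ Finset.Icc 1 T, ENNReal.ofReal (c * a + d * b) :=
          Finset.sum_le_sum fun t _ => h3 t
      _ = _ := by simp [mul_comm]
  · exact le_mul_of_one_le_right' (by exact_mod_cast hT)

end StageCost

/-! ### Removing and inserting control. -/

namespace CodedSystem

variable {Ω : Type} [MeasurableSpace Ω] {μ : Measure Ω} [IsProbabilityMeasure μ] {k l m n : ℕ}
  {A Q : Matrix (Fin k) (Fin k) ℝ} {H : Matrix (Fin m) (Fin n) ℝ} {R : Matrix (Fin m) (Fin m) ℝ}
  {B : Matrix (Fin k) (Fin l) ℝ}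

theorem hasLinearInput_of_control {U : ℕ → Ω → Vec l}
    (sys : CodedSystem μ A Q H R (fun t ω => B.toEuclideanLin (U t ω)))
    {G : (t : ℕ) → (Fin t → Vec m) →ₗ[ℝ] Vec l} (hU : ∀ t ω, U t ω = G t (past sys.Y t ω)) :
    sys.HasLinearInput :=
  fun t => ⟨B.toEuclideanLin ∘ₗ G t, fun ω => by simp only [hU]; rfl⟩

theorem hasLinearInput_zero (sys : CodedSystem μ A Q H R (fun _ _ => 0)) : sys.HasLinearInput :=
  fun _ => ⟨0, fun _ => rfl⟩

theorem memLp_map_past {V : ℕ → Ω → Vec k} {sys : CodedSystem μ A Q H R V}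
    (hV : sys.HasLinearInput) (t : ℕ) (g : (Fin t → Vec m) →ₗ[ℝ] Vec l) :
    MemLp (fun ω => g (past sys.Y t ω)) 2 μ :=
  (LinearMap.toContinuousLinearMap g).comp_memLp' (hV.memLp_past t)

/-- Removing the control from the state yields a control-free system with the same channel
signals. -/
theorem exists_controlFree {U : ℕ → Ω → Vec l}
    (sys : CodedSystem μ A Q H R (fun t ω => B.toEuclideanLin (U t ω)))
    {G : (t : ℕ) → (Fin t → Vec m) →ₗ[ℝ] Vec l} (hU : ∀ t ω, U t ω = G t (past sys.Y t ω)) :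
    ∃ (sys' : CodedSystem μ A Q H R (fun _ _ => 0)) (g : (t : ℕ) → (Fin t → Vec m) →ₗ[ℝ] Vec k),
      sys'.X = sys.X ∧ ∀ t ω, sys'.S t ω - g t (past sys'.Y t ω) = sys.S t ω := by
  -- The recursion ℓ_{t+1} = A ℓ_t - B G_t makes ℓ minus the accumulated effect of the control, so
  -- that adding it to the state cancels the input.
  let ℓ := recursiveFilter (k := k) (m := m) fun t g => A.toEuclideanLin ∘ₗ g -
    B.toEuclideanLin ∘ₗ G t
  have hV' : ∀ t ω, (0 : Vec k) = B.toEuclideanLin (U t ω) + ℓ (t + 1) (past sys.Y (t + 1) ω) -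
      A.toEuclideanLin (ℓ t (past sys.Y t ω)) := fun t ω => by
    simp only [ℓ, recursiveFilter_succ_past, LinearMap.sub_apply, LinearMap.comp_apply, hU]
    abel
  exact ⟨shift (sys.hasLinearInput_of_control hU) ℓ hV', ℓ, rfl, fun t ω =>
    add_sub_cancel_right _ _⟩

/-- Certainty-equivalent control: if the prediction error of a control-free system is bounded in
mean square and the gain `K` makes `quadForm F` a Lyapunov function, then feeding back the
predicted state through `K` keeps state and control bounded in mean square, at the same channel
input. -/
theorem exists_bounded_control (sys : CodedSystem μ A Q H R (fun _ _ => 0)) (hQ : Q.PosDef)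
    {F : Matrix (Fin k) (Fin k) ℝ} {K : Matrix (Fin l) (Fin k) ℝ} {β b c d : ℝ} (hβ0 : 0 ≤ β)
    (hβ : β < 1) (hb : 0 ≤ b) (hc : 0 < c) (hFc : ∀ x : Vec k, c * ‖x‖ ^ 2 ≤ quadForm F x)
    (hF : ∀ x y : Vec k, quadForm F ((A + B * K).toEuclideanLin x + y) ≤
      β * quadForm F x + b * ‖y‖ ^ 2)
    (hd : ∀ t, ∫ ω, ‖predError μ sys.S sys.Y t ω‖ ^ 2 ∂μ ≤ d) :
    ∃ (U : ℕ → Ω → Vec l) (sys' : CodedSystem μ A Q H R (fun t ω => B.toEuclideanLin (U t ω)))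
      (G : (t : ℕ) → (Fin t → Vec m) →ₗ[ℝ] Vec l) (a a' : ℝ),
      sys'.X = sys.X ∧ (∀ t ω, U t ω = G t (past sys'.Y t ω)) ∧
      (∀ t, ∫ ω, ‖sys'.S t ω‖ ^ 2 ∂μ ≤ a) ∧ ∀ t, ∫ ω, ‖U t ω‖ ^ 2 ∂μ ≤ a' := by
  have hV := sys.hasLinearInput_zero
  choose π hπ _ using hV.exists_predictor_eq
  -- Here ℓ is the effect of the control to be inserted. The predictor of the controlled state is π
  -- + ℓ, and U = K(π + ℓ) turns ℓ_{t+1} = A ℓ_t + B U_t into this recursion.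
  let ℓ := recursiveFilter (k := k) (m := m) fun t g => (A + B * K).toEuclideanLin ∘ₗ g +
    (B * K).toEuclideanLin ∘ₗ (π t : (Fin t → Vec m) →ₗ[ℝ] Vec k)
  let G : (t : ℕ) → (Fin t → Vec m) →ₗ[ℝ] Vec l := fun t =>
    K.toEuclideanLin ∘ₗ ((π t : (Fin t → Vec m) →ₗ[ℝ] Vec k) + ℓ t)
  let U : ℕ → Ω → Vec l := fun t ω => G t (past sys.Y t ω)
  have hmul : ∀ x, (B * K).toEuclideanLin x = B.toEuclideanLin (K.toEuclideanLin x) := fun x => by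
    simp [toLpLin_apply]
  have hadd : ∀ x, (A + B * K).toEuclideanLin x =
      A.toEuclideanLin x + (B * K).toEuclideanLin x := fun x => by simp
  have hV' : ∀ t ω, B.toEuclideanLin (U t ω) = 0 + ℓ (t + 1) (past sys.Y (t + 1) ω) -
      A.toEuclideanLin (ℓ t (past sys.Y t ω)) := fun t ω => by
    simp only [ℓ, recursiveFilter_succ_past, LinearMap.add_apply, LinearMap.comp_apply, U, G,
      ← hmul, map_add]
    abel
  let sys' := shift hV ℓ hV'
  have hU : ∀ t ω, U t ω = G t (past sys'.Y t ω) := fun _ _ => rfl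
  have hS := (sys'.hasLinearInput_of_control hU).memLp_S
  set e := predError μ sys.S sys.Y with he
  have heL : ∀ t, MemLp (e t) 2 μ := hV.memLp_predError
  have hUe : ∀ t, U t =ᵐ[μ] fun ω => K.toEuclideanLin (sys'.S t ω - e t ω) := fun t => by
    filter_upwards [hπ t] with ω h
    have h1 : sys'.S t ω = sys.S t ω + ℓ t (past sys.Y t ω) := rfl
    have h2 : e t ω = sys.S t ω - π t (past sys.Y t ω) := by simp only [he, predError, h]
    have h3 : sys'.S t ω - e t ω = π t (past sys.Y t ω) + ℓ t (past sys.Y t ω) := by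
      rw [h1, h2]; abel
    rw [h3]; rfl
  set L := LinearMap.toContinuousLinearMap (B * K).toEuclideanLin with hL
  set M := LinearMap.toContinuousLinearMap K.toEuclideanLin with hM
  have hWL : ∀ t, MemLp (sys.W t) 2 μ := fun t => (sys.hasLaw_W t).hasGaussianLaw.memLp_two
  have hW : ∀ t, ∫ ω, ‖sys.W t ω‖ ^ 2 ∂μ = Q.trace := fun t => by
    simpa [quadForm_one] using integral_quadForm_of_hasLaw (G := 1) hQ.posSemidef (sys.hasLaw_W t)
  have hy : ∀ t, ∫ ω, ‖sys.W t ω - L (e t ω)‖ ^ 2 ∂μ ≤ 2 * Q.trace + 2 * (‖L‖ ^ 2 * d) :=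
    fun t => (integral_sq_norm_sub_le (hWL t) (L.comp_memLp' (heL t))).trans (by
      rw [hW]
      gcongr
      exact (integral_sq_norm_map_le L (heL t)).trans (by gcongr; exact hd t))
  -- Since the controlled state minus e_t is its predictor, the closed loop is A + BK driven by W_t
  -- - BK e_t, whose second moment is bounded.
  have hstep : ∀ t, sys'.S (t + 1) =ᵐ[μ] fun ω =>
      (A + B * K).toEuclideanLin (sys'.S t ω) + (sys.W t ω - L (e t ω)) := fun t => by
    filter_upwards [hUe t] with ω h
    rw [sys'.state_eq, h, ← hmul, map_sub, hadd]
    simp only [hL, LinearMap.coe_toContinuousLinearMap']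
    change _ + _ + sys.W t ω = _
    abel
  have hq0 : ∀ x : Vec k, 0 ≤ quadForm F x := fun x => le_trans (by positivity) (hFc x)
  have hrec : ∀ t, ∫ ω, quadForm F (sys'.S (t + 1) ω) ∂μ ≤
      β * ∫ ω, quadForm F (sys'.S t ω) ∂μ + b * (2 * Q.trace + 2 * (‖L‖ ^ 2 * d)) := fun t => by
    have i1 := (integrable_quadForm F (hS t)).const_mul β
    have i2 := (integrable_sq_norm ((hWL t).sub (L.comp_memLp' (heL t)))).const_mul b
    calc _ ≤ ∫ ω, (β * quadForm F (sys'.S t ω) + b * ‖sys.W t ω - L (e t ω)‖ ^ 2) ∂μ := by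
          refine integral_mono_ae (integrable_quadForm F (hS (t + 1))) (i1.add i2) ?_
          filter_upwards [hstep t] with ω h
          simp only [h]
          exact hF _ _
      _ = β * ∫ ω, quadForm F (sys'.S t ω) ∂μ + b * ∫ ω, ‖sys.W t ω - L (e t ω)‖ ^ 2 ∂μ := by
          rw [← integral_const_mul, ← integral_const_mul]
          exact integral_add i1 i2
      _ ≤ _ := by gcongr; exact hy t
  -- The sign comes from `hy 0`, where the bracket dominates the integral of a square.
  have hy0 : 0 ≤ b * (2 * Q.trace + 2 * (‖L‖ ^ 2 * d)) :=
    mul_nonneg hb ((integral_nonneg fun _ => by positivity).trans (hy 0))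
  have hbound := le_of_affine_recursion (v := fun t => ∫ ω, quadForm F (sys'.S t ω) ∂μ)
    (integral_nonneg fun ω => hq0 (sys'.S 0 ω)) hβ0 hβ hy0 hrec
  set v := ∫ ω, quadForm F (sys'.S 0 ω) ∂μ + b * (2 * Q.trace + 2 * (‖L‖ ^ 2 * d)) / (1 - β)
  have ha : ∀ t, ∫ ω, ‖sys'.S t ω‖ ^ 2 ∂μ ≤ v / c := fun t => by
    rw [le_div_iff₀ hc, mul_comm]
    exact (le_integral_quadForm hFc (hS t)).trans (hbound t)
  refine ⟨U, sys', G, v / c, ‖M‖ ^ 2 * (2 * (v / c) + 2 * d), rfl, hU, ha, fun t => ?_⟩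
  calc ∫ ω, ‖U t ω‖ ^ 2 ∂μ = ∫ ω, ‖M (sys'.S t ω - e t ω)‖ ^ 2 ∂μ := by
        refine integral_congr_ae ?_
        filter_upwards [hUe t] with ω h
        rw [h]; rfl
    _ ≤ ‖M‖ ^ 2 * ∫ ω, ‖sys'.S t ω - e t ω‖ ^ 2 ∂μ :=
        integral_sq_norm_map_le M ((hS t).sub (heL t))
    _ ≤ _ := by
        gcongr
        refine (integral_sq_norm_sub_le (hS t) (heL t)).trans ?_
        gcongr
        exacts [ha t, hd t]

end CodedSystem

end RemoteControl

/-! ### The equivalence. -/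

open RemoteControl

theorem mainTheorem5 {k l m n : ℕ} (A Q : Matrix (Fin k) (Fin k) ℝ)
    (B : Matrix (Fin k) (Fin l) ℝ) (H : Matrix (Fin m) (Fin n) ℝ)
    (R : Matrix (Fin m) (Fin m) ℝ) (C : Matrix (Fin k) (Fin k) ℝ)
    (E : Matrix (Fin l) (Fin l) ℝ) (p : ℝ≥0)
    (hQ : Q.PosDef) (hR : R.PosDef) (hC : C.PosDef) (hE : E.PosDef)
    (hA : ∀ z ∈ spectrum ℂ (A.map (algebraMap ℝ ℂ)), 1 < ‖z‖) :
    RemoteControl.FiniteCostAndStabilityAttainable A Q B H R C E p ↔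
      (∃ D : ℝ≥0, RemoteControl.MSEAchievable A Q H R p D) ∧
        RemoteControl.riccatiCost A Q B C E < ⊤ := by
  constructor
  · rintro ⟨Ω, _, μ, _, U, sys, G, hU, hp, hcost, hstab⟩
    have hV := sys.hasLinearInput_of_control hU
    have hUL : ∀ t, MemLp (U t) 2 μ := fun t => by
      rw [show U t = fun ω => G t (past sys.Y t ω) from funext (hU t)]
      exact CodedSystem.memLp_map_past hV t (G t)
    constructor
    · obtain ⟨D, hD⟩ := exists_forall_le_of_limsup_lt_top hstab fun t =>
        (secondMoment_lt_top_iff (hV.memLp_S t).1).2 (hV.memLp_S t)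
      -- Decoding with minus the removed control effect leaves the controlled state as estimation
      -- error, so its stability bound is the distortion.
      obtain ⟨sys', g, hX, hS⟩ := sys.exists_controlFree hU
      refine ⟨D, Ω, _, μ, ‹_›, sys', fun t => g t, fun t =>
        (LinearMap.continuous_of_finiteDimensional (g t)).measurable, ?_, ?_⟩
      · rw [hX]; exact hp
      · simp only [hS]
        exact longRunAverage_le_of_forall_le hD
    · obtain ⟨c, hc⟩ := eventually_sum_integral_le_of_lqrCost_lt_top hC hE hV.memLp_S hUL hcost
      obtain ⟨F, hF⟩ : ∃ F, IsRiccatiSolution A B C E F := by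
        refine exists_isRiccatiSolution_of_sum_trace_le hQ hC hE (c := c) ?_
        filter_upwards [hc] with T hT
        -- The starting time is 1 because the LQR cost sums from t = 1.
        have h1 := CodedSystem.sum_trace_riccatiIter_le hV hQ hC hE hU T 1
        have h2 : 0 ≤ ∫ ω, quadForm (riccatiIter A B C E T) (sys.S 1 ω) ∂μ :=
          integral_nonneg fun _ => quadForm_nonneg (riccatiIter_posSemidef hC hE T) _
        linarith
      exact (iInf₂_le F hF).trans_lt ENNReal.ofReal_lt_top
  · rintro ⟨⟨D, Ω, _, μ, _, sys, g, hg, hp, hD⟩, hcost⟩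
    obtain ⟨F, hF⟩ : ∃ F, IsRiccatiSolution A B C E F := by
      -- Without a solution the infimum is over an empty family and equals ⊤.
      by_contra! h
      simp [riccatiCost, h] at hcost
    obtain ⟨K, β, b, c, hβ0, hβ, hb, hc, hFc, hFK⟩ := hF.exists_lyapunov hC hE
    obtain ⟨d, -, hd⟩ := sys.hasLinearInput_zero.exists_bound_predError hR hA hg hD
    obtain ⟨U, sys', G, a, a', hX, hU, ha, ha'⟩ :=
      sys.exists_bounded_control hQ hβ0 hβ hb hc hFc hFK hd
    have hV := sys'.hasLinearInput_of_control hU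
    have hUL : ∀ t, MemLp (U t) 2 μ := fun t => by
      rw [show U t = fun ω => G t (past sys'.Y t ω) from funext (hU t)]
      exact CodedSystem.memLp_map_past hV t (G t)
    refine ⟨Ω, _, μ, ‹_›, U, sys', G, hU, ?_,
      lqrCost_lt_top_of_forall_le hC hE hV.memLp_S hUL ha ha', ?_⟩
    · rw [hX]; exact hp
    · refine lt_of_le_of_lt (b := ENNReal.ofReal a) ?_ ENNReal.ofReal_lt_top
      refine limsup_le_of_le (by isBoundedDefault) (.of_forall fun t => ?_)
      rw [ofReal_integral_sq_norm (hV.memLp_S t)]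
      exact ENNReal.ofReal_le_ofReal (ha t)
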